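/- Let $\mathbb{k}$ be an algebraically closed field of characteristic zero (for instance $\mathbb{C}$), let $N\ge 2$, and consider the projective line $\mathbb{P}^1$ over $\mathbb{k}$ with coordinate $z$, the effective divisor $D=N\infty$ and the rational vector field $X=\partial_z=d/dz$. For a commutative $\mathbb{k}$-algebra $R$ with a derivation $\partial$, let $\Psi DO(R,\partial)_{\le 0}$ be the algebra of formal series $\sum_{n\ge 0}a_nD_\partial^{-n}$, $a_n\in R$, with product determined by $D_\partial^{-i}\,b=\sum_{m\ge0}\binom{-i}{m}\partial^m(b)D_\partial^{-i-m}$, and with the topology defined by the subspaces of series with $a_0=\dots=a_{n-1}=0$, $n\ge 0$. If $\partial'=f\partial$ with $f\in R^\times$, then $D_\partial^{-1}\mapsto D_{\partial'}^{-1}f$ induces an $R$-linear isomorphism of topological algebras $\Psi DO(R,\partial)_{\le 0}\to\Psi DO(R,\partial')_{\le 0}$, by which these algebras are identified. Put $B_X^{\mathrm{rat}}=\Psi DO(\mathbb{k}(z),\partial_z)_{\le 0}$. For a point $P\in\mathbb{P}^1$ let $t=z-c$ if $P=c\in\mathbb{k}$ and $t=1/z$ if $P=\infty$; Laurent expansion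 at $P$ (with $\partial_z$ becoming $\partial_t$ if $P\ne\infty$, and $-t^2\partial_t$ if $P=\infty$) gives a morphism $L_P:B_X^{\mathrm{rat}}\to\Psi DO(\mathbb{k}((t)),\partial_t)_{\le 0}$. Let $B_X\subset B_X^{\mathrm{rat}}$ be the subalgebra of all $T$ such that $L_P(T)\in\Psi DO(\mathbb{k}[[t]],\partial_t)_{\le 0}$ for every $P\neq\infty$ and $L_\infty(T)\in \Psi DO(\mathbb{k}[[t]],t^N\partial_t)_{\le 0}$. For $a\ge 0$ put $\tilde\omega_a=\partial_z^{-1}z^a\in B_X^{\mathrm{rat}}$ (where $\partial_z^{-1}=D_{\partial_z}^{-1}$), and let $B'_X$ be the subalgebra of $B_X^{\mathrm{rat}}$ generated by $\tilde\omega_0,\dots,\tilde\omega_{N-2}$. Theorem. (1) For all integers $0\le a,b,c,d\le N-2$ with $a+b=c+d$ and $b>d$, $$\tilde\omega_a\tilde\omega_b-\tilde\omega_c\tilde\omega_d=(d-b)\,\tilde\omega_a\tilde\omega_{b-d-1}\tilde\omega_d .$$ (2) Let $C$ be the associative unital $\mathbb{k}$-algebra with generators $t_a$, $a=0,\dots,N-2$,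 and relations $t_at_b-t_ct_d=(d-b)\,t_at_{b-d-1}t_d$ for all $a,b,c,d\in\{0,\dots,N-2\}$ with $a+b=c+d$ and $b>d$. Let $I_C$ be the two-sided ideal of $C$ generated by the $t_a$, and let $\widehat C=\varprojlim_n C/I_C^n$, with the inverse limit topology of the discrete algebras $C/I_C^n$. Then there is a unique continuous algebra isomorphism $\widehat C\to B_X$ taking each $t_a$ to $\tilde\omega_a$, where $B_X$ carries the topology induced from $B_X^{\mathrm{rat}}$. (3) This isomorphism induces an algebra isomorphism $C/\bigcap_{n\ge 0}I_C^n\to B'_X$. -/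

import Mathlib

open scoped PowerSeries LaurentSeries Polynomial

noncomputable section

/-! ## Formal pseudodifferential operators of degree `≤ 0` -/

/-- The underlying set of `PsiDO(R, ∂)_{≤ 0}`: the element `x` stands for the formal series
`∑_{n ≥ 0} x.coeff n · D_∂^{-n}`. -/
@[ext] structure PsiDO {k R : Type*} [CommRing k] [CommRing R] [Algebra k R]
    (der : Derivation k R R) where
  /-- `x.coeff n` is the coefficient of `D_∂^{-n}`. -/
  coeff : ℕ → R

namespace PsiDO

section Basic

variable {k R : Type*} [CommRing k] [CommRing R] [Algebra k R] {der : Derivation k R R}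

/-- The product `(∑ a_i D^{-i}) (∑ b_j D^{-j}) = ∑_{i,m,j} binom(-i, m) a_i ∂^m(b_j) D^{-(i+m+j)}`. -/
instance : Mul (PsiDO der) where
  mul x y := ⟨fun n => ∑ p ∈ Finset.HasAntidiagonal.antidiagonal n, ∑ q ∈ Finset.HasAntidiagonal.antidiagonal p.2,
    (Ring.choose (-(p.1 : ℤ)) q.1) • (x.coeff p.1 * der^[q.1] (y.coeff q.2))⟩

instance : Zero (PsiDO der) := ⟨⟨0⟩⟩
instance : Add (PsiDO der) := ⟨fun x y => ⟨x.coeff + y.coeff⟩⟩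
instance : Neg (PsiDO der) := ⟨fun x => ⟨-x.coeff⟩⟩
instance : Sub (PsiDO der) := ⟨fun x y => ⟨x.coeff - y.coeff⟩⟩
instance : SMul ℕ (PsiDO der) := ⟨fun n x => ⟨n • x.coeff⟩⟩
instance : SMul ℤ (PsiDO der) := ⟨fun n x => ⟨n • x.coeff⟩⟩

theorem coeff_injective : Function.Injective (coeff : PsiDO der → ℕ → R) :=
  fun _ _ h => PsiDO.ext h

instance : AddCommGroup (PsiDO der) :=
  coeff_injective.addCommGroup coeff rfl (fun _ _ => rfl) (fun _ => rfl) (fun _ _ => rfl)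
    (fun _ _ => rfl) (fun _ _ => rfl)

@[simp] theorem coeff_zero (n : ℕ) : (0 : PsiDO der).coeff n = 0 := rfl
@[simp] theorem coeff_add (x y : PsiDO der) (n : ℕ) :
    (x + y).coeff n = x.coeff n + y.coeff n := rfl
@[simp] theorem coeff_neg (x : PsiDO der) (n : ℕ) : (-x).coeff n = -x.coeff n := rfl
@[simp] theorem coeff_sub (x y : PsiDO der) (n : ℕ) :
    (x - y).coeff n = x.coeff n - y.coeff n := rfl

theorem coeff_mul (x y : PsiDO der) (n : ℕ) :
    (x * y).coeff n = ∑ p ∈ Finset.HasAntidiagonal.antidiagonal n, ∑ q ∈ Finset.HasAntidiagonal.antidiagonal p.2,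
      (Ring.choose (-(p.1 : ℤ)) q.1) • (x.coeff p.1 * der^[q.1] (y.coeff q.2)) := rfl

/-- The operator of multiplication by `a`, that is, `a · D^0`. -/
def const (der : Derivation k R R) (a : R) : PsiDO der := ⟨fun n => if n = 0 then a else 0⟩

instance : One (PsiDO der) := ⟨const der 1⟩

/-- The element `D_∂^{-1}`. -/
def Dinv (der : Derivation k R R) : PsiDO der := ⟨fun n => if n = 1 then 1 else 0⟩

theorem coeff_const (a : R) (n : ℕ) : (const der a).coeff n = if n = 0 then a else 0 := rfl
theorem coeff_one (n : ℕ) : (1 : PsiDO der).coeff n = if n = 0 then 1 else 0 := rfl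
theorem coeff_Dinv (n : ℕ) : (Dinv der).coeff n = if n = 1 then 1 else 0 := rfl

/-! ### Ring axioms

Left multiplication by `D^{-1}` is described by the recursion `shiftInv`; the product is then
`(x * y)_n = ∑_{i ≤ n} x_i (D^{-i} y)_n`, from which associativity follows. -/

/-- Left multiplication by `D^{-1}` on coefficient sequences. -/
def shiftInv (der : Derivation k R R) (y : ℕ → R) : ℕ → R
  | 0 => 0
  | n + 1 => y n - der (shiftInv der y n)

theorem shiftInv_unique {y w : ℕ → R} (h0 : w 0 = 0) (h : ∀ n, w (n + 1) + der (w n) = y n) :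
    w = shiftInv der y := by
  funext n
  induction n with
  | zero => simpa [shiftInv] using h0
  | succ n ih => rw [shiftInv, ← ih, ← h n]; ring

theorem shiftInv_succ (y : ℕ → R) (n : ℕ) :
    shiftInv der y (n + 1) + der (shiftInv der y n) = y n := by
  rw [shiftInv]; ring

theorem iterate_shiftInv_lt (y : ℕ → R) {i n : ℕ} (h : n < i) : (shiftInv der)^[i] y n = 0 := by
  induction i generalizing n with
  | zero => omega
  | succ i ih =>
    rw [Function.iterate_succ_apply']
    induction n with
    | zero => rfl
    | succ n ihn =>
      rw [shiftInv, ih (by omega), ihn (by omega)]; simp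

theorem shiftInv_add (y z : ℕ → R) :
    shiftInv der (y + z) = shiftInv der y + shiftInv der z := by
  symm
  apply shiftInv_unique
  · simp [shiftInv]
  · intro n
    have h1 := shiftInv_succ (der := der) y n
    have h2 := shiftInv_succ (der := der) z n
    simp only [Pi.add_apply, map_add]
    rw [← h1, ← h2]; ring

theorem iterate_shiftInv_add (y z : ℕ → R) (i : ℕ) :
    (shiftInv der)^[i] (y + z) = (shiftInv der)^[i] y + (shiftInv der)^[i] z := by
  induction i with
  | zero => rfl
  | succ i ih => simp only [Function.iterate_succ_apply', ih, shiftInv_add]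

theorem iterate_shiftInv_eq (y : ℕ → R) (i m : ℕ) :
    (shiftInv der)^[i] y (i + m) =
      ∑ q ∈ Finset.HasAntidiagonal.antidiagonal m, (Ring.choose (-(i : ℤ)) q.1) • der^[q.1] (y q.2) := by
  induction i generalizing m with
  | zero =>
    cases m with
    | zero => simp
    | succ m =>
      rw [Finset.Nat.sum_antidiagonal_succ]
      simp [Ring.choose_zero_succ]
  | succ i ih =>
    rw [Function.iterate_succ_apply']
    have key : ∀ m, shiftInv der ((shiftInv der)^[i] y) (i + 1 + m) =
        ∑ q ∈ Finset.HasAntidiagonal.antidiagonal m,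
          (Ring.choose (-((i + 1 : ℕ) : ℤ)) q.1) • der^[q.1] (y q.2) := by
      intro m
      have pascal : ∀ q : ℕ, Ring.choose (-(i : ℤ)) (q + 1) =
          Ring.choose (-((i + 1 : ℕ) : ℤ)) q + Ring.choose (-((i + 1 : ℕ) : ℤ)) (q + 1) := by
        intro q
        rw [← Ring.choose_succ_succ]; congr 1; push_cast; ring
      induction m with
      | zero =>
        rw [Nat.add_zero, shiftInv, ← Function.iterate_succ_apply' (shiftInv der),
          iterate_shiftInv_lt y (Nat.lt_succ_self i), map_zero, sub_zero]
        have := ih 0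
        simpa using this
      | succ m ihm =>
        have e : i + 1 + (m + 1) = (i + 1 + m) + 1 := by ring
        rw [e, shiftInv, ihm]
        have := ih (m + 1)
        rw [show i + (m + 1) = i + 1 + m by ring] at this
        rw [this, Finset.Nat.sum_antidiagonal_succ, Finset.Nat.sum_antidiagonal_succ, map_sum,
          sub_eq_iff_eq_add, add_assoc, ← Finset.sum_add_distrib]
        congr 1
        · simp
        · refine Finset.sum_congr rfl fun q _ => ?_
          rw [pascal, add_smul, map_zsmul, Function.iterate_succ_apply']
          exact add_comm _ _
    exact key m

theorem coeff_mul_eq (x y : PsiDO der) (n : ℕ) :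
    (x * y).coeff n =
      ∑ i ∈ Finset.range (n + 1), x.coeff i * (shiftInv der)^[i] y.coeff n := by
  rw [coeff_mul, Finset.Nat.sum_antidiagonal_eq_sum_range_succ_mk]
  refine Finset.sum_congr rfl fun i hi => ?_
  have hi' : i ≤ n := Nat.lt_succ_iff.mp (Finset.mem_range.mp hi)
  conv_rhs => rw [show n = i + (n - i) by omega]
  rw [iterate_shiftInv_eq, Finset.mul_sum]
  exact Finset.sum_congr rfl fun q _ => (mul_smul_comm _ _ _).symm

theorem coeff_mul_eq_of_lt (x y : PsiDO der) {n M : ℕ} (h : n < M) :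
    (x * y).coeff n = ∑ i ∈ Finset.range M, x.coeff i * (shiftInv der)^[i] y.coeff n := by
  rw [coeff_mul_eq]
  apply Finset.sum_subset
  · intro i; simp; omega
  · intro i _ hi
    rw [iterate_shiftInv_lt, mul_zero]
    simpa using hi

/-- Left multiplication by `D^{-1}`. -/
def shift (y : PsiDO der) : PsiDO der := ⟨shiftInv der y.coeff⟩

theorem coeff_iterate_shift (y : PsiDO der) (i : ℕ) :
    (shift^[i] y).coeff = (shiftInv der)^[i] y.coeff := by
  induction i with
  | zero => rfl
  | succ i ih => simp only [Function.iterate_succ_apply', ← ih]; rfl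

theorem shift_mul (x z : PsiDO der) : shift x * z = shift (x * z) := by
  apply coeff_injective
  change (shift x * z).coeff = shiftInv der (x * z).coeff
  apply shiftInv_unique
  · rw [coeff_mul_eq]; simp [shift, shiftInv]
  · intro n
    rw [coeff_mul_eq_of_lt _ _ (Nat.lt_succ_self (n + 1)), coeff_mul_eq_of_lt (shift x) z
      (show n < n + 2 by omega), coeff_mul_eq]
    rw [map_sum]
    simp only [Derivation.leibniz, smul_eq_mul]
    rw [Finset.sum_add_distrib, ← add_assoc, ← Finset.sum_add_distrib]
    simp only [← mul_add]
    rw [Finset.sum_range_succ', Finset.sum_range_succ _ (n + 1)]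
    simp only [shift, shiftInv, zero_mul, add_zero, Function.iterate_succ_apply',
      sub_add_cancel]
    rw [← Function.iterate_succ_apply' (shiftInv der),
      iterate_shiftInv_lt z.coeff (Nat.lt_succ_self n), zero_mul, add_zero,
      ← Finset.sum_add_distrib]
    exact Finset.sum_congr rfl fun i _ => by ring

theorem iterate_shift_mul (x z : PsiDO der) (i : ℕ) : shift^[i] x * z = shift^[i] (x * z) := by
  induction i with
  | zero => rfl
  | succ i ih => simp only [Function.iterate_succ_apply', shift_mul, ih]

protected theorem mul_assoc' (x y z : PsiDO der) : x * y * z = x * (y * z) := by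
  ext n
  rw [coeff_mul_eq]
  have h1 : ∀ i ∈ Finset.range (n + 1), (x * y).coeff i * (shiftInv der)^[i] z.coeff n =
      ∑ j ∈ Finset.range (n + 1), x.coeff j *
        ((shiftInv der)^[j] y.coeff i * (shiftInv der)^[i] z.coeff n) := by
    intro i hi
    rw [coeff_mul_eq_of_lt _ _ (Finset.mem_range.mp hi), Finset.sum_mul]
    exact Finset.sum_congr rfl fun j _ => by ring
  rw [Finset.sum_congr rfl h1, Finset.sum_comm, coeff_mul_eq]
  refine Finset.sum_congr rfl fun j _ => ?_
  rw [← Finset.mul_sum, ← coeff_iterate_shift, ← coeff_iterate_shift (y * z),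
    ← iterate_shift_mul, coeff_mul_eq]

theorem const_mul_coeff (a : R) (y : PsiDO der) (n : ℕ) :
    (const der a * y).coeff n = a * y.coeff n := by
  rw [coeff_mul_eq, Finset.sum_range_succ']
  simp [coeff_const]

theorem Dinv_mul (y : PsiDO der) : Dinv der * y = shift y := by
  ext n
  rw [coeff_mul_eq_of_lt _ _ (show n < n + 2 by omega), Finset.sum_range_succ',
    Finset.sum_range_succ']
  simp [coeff_Dinv, shift]

theorem iterate_shiftInv_const (a : R) (ha : der a = 0) (i : ℕ) :
    (shiftInv der)^[i] (const der a).coeff = fun n => if n = i then a else 0 := by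
  induction i with
  | zero => rfl
  | succ i ih =>
    rw [Function.iterate_succ_apply', ih]
    symm
    apply shiftInv_unique
    · simp
    · intro n
      have : der (if n = i + 1 then a else 0) = 0 := by split_ifs <;> simp [ha]
      simp [this]

theorem mul_const_coeff (x : PsiDO der) (a : R) (ha : der a = 0) (n : ℕ) :
    (x * const der a).coeff n = x.coeff n * a := by
  rw [coeff_mul_eq, Finset.sum_range_succ]
  simp only [iterate_shiftInv_const a ha, if_true]
  rw [Finset.sum_eq_zero, zero_add]
  intro i hi
  rw [if_neg (by have := Finset.mem_range.mp hi; omega), mul_zero]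

instance : Ring (PsiDO der) :=
  { (inferInstance : AddCommGroup (PsiDO der)) with
    mul := (· * ·)
    one := 1
    mul_assoc := PsiDO.mul_assoc'
    one_mul := fun x => by
      ext n; exact (const_mul_coeff 1 x n).trans (one_mul _)
    mul_one := fun x => by
      ext n; exact (mul_const_coeff x 1 der.map_one_eq_zero n).trans (mul_one _)
    zero_mul := fun x => by ext n; simp [coeff_mul_eq]
    mul_zero := fun x => by
      ext n
      have h : ∀ i, (shiftInv der)^[i] (0 : PsiDO der).coeff = 0 := by
        intro i
        induction i with
        | zero => rfl
        | succ i ih =>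
          rw [Function.iterate_succ_apply', ih]
          exact (shiftInv_unique rfl (by simp)).symm
      simp [coeff_mul_eq, h]
    left_distrib := fun x y z => by
      ext n
      have h : (y + z).coeff = y.coeff + z.coeff := rfl
      simp only [coeff_mul_eq, coeff_add, h, iterate_shiftInv_add, Pi.add_apply, mul_add,
        Finset.sum_add_distrib]
    right_distrib := fun x y z => by
      ext n
      simp only [coeff_mul_eq, coeff_add, add_mul, Finset.sum_add_distrib]
    zsmul := (· • ·)
    zsmul_zero' := fun x => zero_smul ℤ x
    zsmul_succ' := fun n x => SubNegMonoid.zsmul_succ' n x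
    zsmul_neg' := fun n x => SubNegMonoid.zsmul_neg' n x }

/-- Functions, as operators of degree `0`. -/
def constHom (der : Derivation k R R) : R →+* PsiDO der where
  toFun := const der
  map_one' := rfl
  map_zero' := by ext n; simp [coeff_const]
  map_add' a b := by ext n; simp only [coeff_const, coeff_add]; split_ifs <;> simp
  map_mul' a b := by ext n; simp only [coeff_const, const_mul_coeff]; split_ifs <;> simp

instance : Algebra k (PsiDO der) :=
  ((constHom der).comp (algebraMap k R)).toAlgebra' fun c x => by
    ext n
    change (const der _ * x).coeff n = (x * const der _).coeff n
    rw [const_mul_coeff, mul_const_coeff _ _ (by simp), mul_comm]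

theorem algebraMap_eq (c : k) :
    algebraMap k (PsiDO der) c = const der (algebraMap k R c) := rfl

/-- The topology of `PsiDO(R, ∂)_{≤ 0}` defined by the subspaces `PsiDO(R, ∂)_{≤ -n}`, `n ≥ 0`:
the coarsest one for which all coefficients are locally constant. -/
instance : TopologicalSpace (PsiDO der) :=
  ⨅ n : ℕ, TopologicalSpace.induced (fun x : PsiDO der => x.coeff n) ⊥

end Basic

section Functoriality

variable {k R S : Type*} [CommRing k] [CommRing R] [Algebra k R] [CommRing S] [Algebra k S]

/-- The morphism `PsiDO(μ) : ∑ a_n D_∂^{-n} ↦ ∑ μ(a_n) D_∂'^{-n}` induced by a morphism `μ` of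
differential rings. -/
def map {der : Derivation k R R} {der' : Derivation k S S} (μ : R →ₐ[k] S)
    (h : ∀ a, der' (μ a) = μ (der a)) : PsiDO der →ₐ[k] PsiDO der' where
  toFun x := ⟨fun n => μ (x.coeff n)⟩
  map_one' := by ext n; simp only [coeff_one]; split_ifs <;> simp
  map_mul' x y := by
    have hit : ∀ (m : ℕ) (a : R), μ (der^[m] a) = der'^[m] (μ a) := by
      intro m a
      induction m with
      | zero => rfl
      | succ m ih => rw [Function.iterate_succ_apply', Function.iterate_succ_apply', ← ih, h]
    ext n
    simp only [coeff_mul, map_sum, map_zsmul, map_mul, hit]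
  map_zero' := by ext n; simp
  map_add' x y := by ext n; simp
  commutes' c := by
    ext n; simp only [algebraMap_eq, coeff_const]; split_ifs <;> simp

variable {der der' : Derivation k R R}

theorem const_add (a b : R) : const der (a + b) = const der a + const der b :=
  map_add (constHom der) a b

theorem Dinv_const (b : R) :
    Dinv der * const der b = const der b * Dinv der - Dinv der * const der (der b) * Dinv der := by
  rw [mul_assoc, Dinv_mul, Dinv_mul]
  apply coeff_injective
  change shiftInv der _ = _
  symm
  apply shiftInv_unique
  · simp [const_mul_coeff, coeff_Dinv, shift, shiftInv]
  · intro n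
    have h := shiftInv_succ (der := der) (const der (der b) * Dinv der).coeff n
    simp only [coeff_sub, map_sub, const_mul_coeff, shift] at h ⊢
    rw [sub_add_sub_comm, h]
    simp only [coeff_Dinv, coeff_const]
    rcases n with _ | _ | n <;> simp

/-- The image `(f⁻¹ D_∂')⁻¹ = D_∂'⁻¹ f` of `D_∂⁻¹` under `i_{∂,∂'}`, where `∂' = f ∂`. -/
def gen (der' : Derivation k R R) (f : R) : PsiDO der' := Dinv der' * const der' f

theorem coeff_mul_congr (x : PsiDO der) {y z : PsiDO der} {n : ℕ}
    (h : ∀ m ≤ n, y.coeff m = z.coeff m) : (x * y).coeff n = (x * z).coeff n := by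
  rw [coeff_mul, coeff_mul]
  refine Finset.sum_congr rfl fun p hp => Finset.sum_congr rfl fun q hq => ?_
  rw [h q.2]
  have h1 := Finset.HasAntidiagonal.mem_antidiagonal.mp hp
  have h2 := Finset.HasAntidiagonal.mem_antidiagonal.mp hq
  omega

theorem coeff_gen_pow_mul (f : R) (y : PsiDO der') {i n : ℕ} (h : n < i) :
    (gen der' f ^ i * y).coeff n = 0 := by
  induction i generalizing n with
  | zero => omega
  | succ i ih =>
    rw [pow_succ', mul_assoc, gen, mul_assoc, Dinv_mul]
    induction n with
    | zero => rfl
    | succ n ihn =>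
      have := ihn (by omega)
      change shiftInv der' _ n = 0 at this
      change shiftInv der' _ (n + 1) = 0
      rw [shiftInv, this, const_mul_coeff, ← gen, ih (by omega)]
      simp

theorem coeff_gen_pow (f : R) {i n : ℕ} (h : n < i) : (gen der' f ^ i).coeff n = 0 := by
  simpa using coeff_gen_pow_mul f (1 : PsiDO der') h

/-- The underlying function of `i_{∂,∂'}`: the sum of the convergent series
`∑_i a_i (D_∂'⁻¹ f)^i`. -/
def changeFun (der' : Derivation k R R) (f : R) (x : PsiDO der) : PsiDO der' :=
  ⟨fun n => ∑ i ∈ Finset.range (n + 1), x.coeff i * (gen der' f ^ i).coeff n⟩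

theorem coeff_sum_const_mul (x : PsiDO der) (y : ℕ → PsiDO der') (M n : ℕ) :
    (∑ i ∈ Finset.range M, const der' (x.coeff i) * y i).coeff n =
      ∑ i ∈ Finset.range M, x.coeff i * (y i).coeff n := by
  induction M with
  | zero => rfl
  | succ M ih => rw [Finset.sum_range_succ, Finset.sum_range_succ, coeff_add, ih, const_mul_coeff]

theorem changeFun_coeff (f : R) (x : PsiDO der) {n M : ℕ} (h : n < M) :
    (changeFun der' f x).coeff n =
      (∑ i ∈ Finset.range M, const der' (x.coeff i) * gen der' f ^ i).coeff n := by
  rw [coeff_sum_const_mul]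
  change ∑ i ∈ Finset.range (n + 1), x.coeff i * (gen der' f ^ i).coeff n = _
  apply Finset.sum_subset
  · intro i; simp; omega
  · intro i _ hi
    rw [coeff_gen_pow, mul_zero]
    simpa using hi

theorem gen_const (f : R) (h : ∀ a, der' a = f * der a) (b : R) :
    gen der' f * const der' (der b) * gen der' f =
      const der' b * gen der' f - gen der' f * const der' b := by
  have e1 : const der' f * const der' (der b) = const der' (der' b) := by
    rw [h]; exact ((constHom der').map_mul f (der b)).symm
  have e2 : const der' f * const der' b = const der' b * const der' f := by
    change constHom der' f * constHom der' b = constHom der' b * constHom der' f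
    rw [← map_mul, ← map_mul, mul_comm]
  have e3 := Dinv_const (der := der') b
  calc gen der' f * const der' (der b) * gen der' f
      = Dinv der' * (const der' f * const der' (der b)) * Dinv der' * const der' f := by
        simp only [gen, mul_assoc]
    _ = (const der' b * Dinv der' - Dinv der' * const der' b) * const der' f := by
        rw [e1, e3]; congr 1; abel
    _ = _ := by
        simp only [gen, sub_mul, mul_assoc, e2]

theorem changeFun_shift (f : R) (h : ∀ a, der' a = f * der a) (x : PsiDO der) :
    changeFun der' f (shift x) = gen der' f * changeFun der' f x := by
  set F := gen der' f with hF
  set w := shift x with hw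
  have hx : ∀ i, x.coeff i = w.coeff (i + 1) + der (w.coeff i) := fun i =>
    (shiftInv_succ (der := der) x.coeff i).symm
  have hfin : ∀ M, F * ∑ i ∈ Finset.range (M + 1), const der' (x.coeff i) * F ^ i =
      (∑ i ∈ Finset.range (M + 1), const der' (w.coeff i) * F ^ i) +
        F * const der' (w.coeff (M + 1)) * F ^ M := by
    intro M
    have w0 : w.coeff 0 = 0 := rfl
    induction M with
    | zero =>
      have c0 : const der' (0 : R) = 0 := (constHom der').map_zero
      simp [hx, w0, c0]
    | succ M ih =>
      rw [Finset.sum_range_succ, mul_add, ih, Finset.sum_range_succ _ (M + 1), hx (M + 1),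
        const_add, add_mul, mul_add]
      have := gen_const (der := der) f h (w.coeff (M + 1))
      have e : F * (const der' (der (w.coeff (M + 1))) * F ^ (M + 1)) =
          (const der' (w.coeff (M + 1)) * F - F * const der' (w.coeff (M + 1))) * F ^ M := by
        rw [← this]; simp only [pow_succ', mul_assoc, hF]
      rw [e, sub_mul]
      simp only [pow_succ', mul_assoc]
      abel
  ext n
  rw [changeFun_coeff f w (Nat.lt_succ_self n),
    coeff_mul_congr F (z := ∑ i ∈ Finset.range (n + 2), const der' (x.coeff i) * F ^ i)
      (fun m hm => changeFun_coeff f x (by omega)), hfin (n + 1),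
    coeff_add, ← changeFun_coeff f w (show n < n + 2 by omega),
    ← changeFun_coeff f w (Nat.lt_succ_self n)]
  have : (F * const der' (w.coeff (n + 1 + 1)) * F ^ (n + 1)).coeff n = 0 := by
    rw [mul_assoc, coeff_mul_congr F (z := 0), mul_zero, coeff_zero]
    intro m hm
    rw [const_mul_coeff, coeff_gen_pow f (by omega), mul_zero, coeff_zero]
  rw [this, add_zero]

theorem changeFun_iterate_shift (f : R) (h : ∀ a, der' a = f * der a) (x : PsiDO der) (i : ℕ) :
    changeFun der' f (shift^[i] x) = gen der' f ^ i * changeFun der' f x := by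
  induction i with
  | zero => simp
  | succ i ih => rw [Function.iterate_succ_apply', changeFun_shift f h, ih, pow_succ', mul_assoc]

theorem sum_mul_coeff (x : PsiDO der) (G : ℕ → PsiDO der') (y : PsiDO der') (M n : ℕ) :
    ((∑ i ∈ Finset.range M, const der' (x.coeff i) * G i) * y).coeff n =
      ∑ i ∈ Finset.range M, x.coeff i * (G i * y).coeff n := by
  rw [Finset.sum_mul]
  simp only [mul_assoc]
  exact coeff_sum_const_mul x (fun i => G i * y) M n

theorem changeFun_mul (f : R) (h : ∀ a, der' a = f * der a) (x y : PsiDO der) :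
    changeFun der' f (x * y) = changeFun der' f x * changeFun der' f y := by
  ext n
  have hl : (changeFun der' f x * changeFun der' f y).coeff n =
      ((∑ i ∈ Finset.range (n + 1), const der' (x.coeff i) * gen der' f ^ i) *
        changeFun der' f y).coeff n := by
    rw [coeff_mul_eq, coeff_mul_eq]
    refine Finset.sum_congr rfl fun i hi => ?_
    rw [changeFun_coeff f x (Finset.mem_range.mp hi)]
  rw [hl, sum_mul_coeff]
  simp only [← changeFun_iterate_shift f h]
  change ∑ i ∈ Finset.range (n + 1), (x * y).coeff i * (gen der' f ^ i).coeff n = _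
  have h1 : ∀ i ∈ Finset.range (n + 1), (x * y).coeff i * (gen der' f ^ i).coeff n =
      ∑ j ∈ Finset.range (n + 1), x.coeff j *
        ((shift^[j] y).coeff i * (gen der' f ^ i).coeff n) := by
    intro i hi
    rw [coeff_mul_eq_of_lt _ _ (Finset.mem_range.mp hi), Finset.sum_mul]
    refine Finset.sum_congr rfl fun j _ => ?_
    rw [coeff_iterate_shift]; ring
  rw [Finset.sum_congr rfl h1, Finset.sum_comm]
  refine Finset.sum_congr rfl fun j _ => ?_
  rw [← Finset.mul_sum]; rfl

theorem changeFun_const (f : R) (a : R) : changeFun der' f (const der a) = const der' a := by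
  ext n
  change ∑ i ∈ Finset.range (n + 1), _ = _
  rw [Finset.sum_range_succ']
  simp [coeff_const, coeff_one]

/-- For derivations with `∂' = f ∂`, the morphism `i_{∂,∂'} : PsiDO(R, ∂)_{≤ 0} →
PsiDO(R, ∂')_{≤ 0}`, `∑ a_i D_∂^{-i} ↦ ∑ a_i (f⁻¹ D_∂')^{-i} = ∑ a_i (D_∂'⁻¹ f)^i`. It is an
isomorphism when `f` is invertible. -/
def changeDer (der der' : Derivation k R R) (f : R) (h : ∀ a, der' a = f * der a) :
    PsiDO der →ₐ[k] PsiDO der' where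
  toFun := changeFun der' f
  map_one' := changeFun_const f 1
  map_mul' := changeFun_mul f h
  map_zero' := by ext n; simp [changeFun]
  map_add' x y := by ext n; simp [changeFun, add_mul, Finset.sum_add_distrib]
  commutes' c := changeFun_const f _

end Functoriality

end PsiDO

/-! ## Extension of derivations to fraction fields -/

section FractionField

variable {k A : Type*} (K : Type*) [CommRing k] [CommRing A] [IsDomain A] [Field K] [Algebra k A]
  [Algebra A K] [IsFractionRing A K] (d : Derivation k A A)

/-- The value of the extended derivation, computed on a chosen presentation as a fraction. -/
def fracDerFun (x : K) : K :=
  (algebraMap A K (d (IsLocalization.sec (nonZeroDivisors A) x).1) *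
      algebraMap A K (IsLocalization.sec (nonZeroDivisors A) x).2 -
    algebraMap A K (IsLocalization.sec (nonZeroDivisors A) x).1 *
      algebraMap A K (d (IsLocalization.sec (nonZeroDivisors A) x).2)) /
    algebraMap A K (IsLocalization.sec (nonZeroDivisors A) x).2 ^ 2

theorem fracDerFun_eq {x : K} {p q : A} (hq : q ≠ 0) (h : x * algebraMap A K q = algebraMap A K p) :
    fracDerFun K d x =
      (algebraMap A K (d p) * algebraMap A K q - algebraMap A K p * algebraMap A K (d q)) /
        algebraMap A K q ^ 2 := by
  unfold fracDerFun
  have hs := IsLocalization.sec_spec (nonZeroDivisors A) x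
  set n := (IsLocalization.sec (nonZeroDivisors A) x).1
  set s := (IsLocalization.sec (nonZeroDivisors A) x).2
  have hs0 : algebraMap A K s ≠ 0 :=
    IsFractionRing.to_map_ne_zero_of_mem_nonZeroDivisors s.2
  have hq0 : algebraMap A K q ≠ 0 := by
    simpa using hq
  have e : p * (s : A) = n * q := by
    apply IsFractionRing.injective A K
    rw [map_mul, map_mul, ← h, ← hs]; ring
  have e' := congrArg (fun a => algebraMap A K (d a)) e
  have e'' := congrArg (algebraMap A K) e
  simp only [Derivation.leibniz, smul_eq_mul, map_add, map_mul] at e' e''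
  rw [div_eq_div_iff (pow_ne_zero 2 hs0) (pow_ne_zero 2 hq0)]
  linear_combination (algebraMap A K q * algebraMap A K (s : A)) * (-e') +
    (algebraMap A K (s : A) * algebraMap A K (d q) + algebraMap A K q * algebraMap A K (d s)) * e''

theorem fracDerFun_div (p : A) {q : A} (hq : q ≠ 0) :
    fracDerFun K d (algebraMap A K p / algebraMap A K q) =
      (algebraMap A K (d p) * algebraMap A K q - algebraMap A K p * algebraMap A K (d q)) /
        algebraMap A K q ^ 2 := by
  have hq0 : algebraMap A K q ≠ 0 := by simpa using hq
  exact fracDerFun_eq K d hq (div_mul_cancel₀ _ hq0)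

variable [Algebra k K] [IsScalarTower k A K]

/-- The unique extension of a derivation of a domain to its fraction field,
`(p / q)' = (p' q - p q') / q ^ 2`. -/
def fracDer : Derivation k K K :=
  Derivation.mk'
    { toFun := fracDerFun K d
      map_add' := fun x y => by
        obtain ⟨p, q, hq, rfl⟩ := IsFractionRing.div_surjective A x
        obtain ⟨r, s, hs, rfl⟩ := IsFractionRing.div_surjective A y
        have hq' := nonZeroDivisors.ne_zero hq
        have hs' := nonZeroDivisors.ne_zero hs
        have hq0 : algebraMap A K q ≠ 0 := by simpa using hq'
        have hs0 : algebraMap A K s ≠ 0 := by simpa using hs'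
        have e : algebraMap A K p / algebraMap A K q + algebraMap A K r / algebraMap A K s =
            algebraMap A K (p * s + q * r) / algebraMap A K (q * s) := by
          rw [div_add_div _ _ hq0 hs0]; simp only [map_add, map_mul]
        rw [e, fracDerFun_div K d _ hq', fracDerFun_div K d _ hs',
          fracDerFun_div K d _ (mul_ne_zero hq' hs')]
        simp only [Derivation.leibniz, smul_eq_mul, map_add, map_mul]
        field_simp
        ring
      map_smul' := fun c x => by
        obtain ⟨p, q, hq, rfl⟩ := IsFractionRing.div_surjective A x
        have hq' := nonZeroDivisors.ne_zero hq
        have hsm : ∀ a : A, algebraMap A K (c • a) = c • algebraMap A K a := fun a => by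
          rw [Algebra.smul_def, Algebra.smul_def, map_mul, ← IsScalarTower.algebraMap_apply]
        rw [RingHom.id_apply, ← smul_div_assoc, ← hsm, fracDerFun_div K d _ hq',
          fracDerFun_div K d _ hq', Derivation.map_smul, hsm, hsm, smul_mul_assoc, smul_mul_assoc,
          ← smul_sub, smul_div_assoc] }
    (fun x y => by
      change fracDerFun K d (x * y) = x * fracDerFun K d y + y * fracDerFun K d x
      obtain ⟨p, q, hq, rfl⟩ := IsFractionRing.div_surjective A x
      obtain ⟨r, s, hs, rfl⟩ := IsFractionRing.div_surjective A y
      have hq' := nonZeroDivisors.ne_zero hq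
      have hs' := nonZeroDivisors.ne_zero hs
      have hq0 : algebraMap A K q ≠ 0 := by simpa using hq'
      have hs0 : algebraMap A K s ≠ 0 := by simpa using hs'
      have e : algebraMap A K p / algebraMap A K q * (algebraMap A K r / algebraMap A K s) =
          algebraMap A K (p * r) / algebraMap A K (q * s) := by
        rw [div_mul_div_comm]; simp only [map_mul]
      rw [e, fracDerFun_div K d _ hq', fracDerFun_div K d _ hs',
        fracDerFun_div K d _ (mul_ne_zero hq' hs')]
      simp only [Derivation.leibniz, smul_eq_mul, map_add, map_mul]
      field_simp
      ring)

theorem fracDer_algebraMap (a : A) : fracDer K d (algebraMap A K a) = algebraMap A K (d a) := by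
  change fracDerFun K d _ = _
  rw [fracDerFun_eq K d (p := a) (q := 1) one_ne_zero (by simp)]
  simp

end FractionField

/-! ## The projective line: function field, points, Laurent expansions -/

section ProjectiveLine

variable (𝕜 : Type*) [Field 𝕜]

/-- The derivation `∂_z = d/dz` of the field `𝕜(z)` of rational functions on the projective line. -/
def ratDer : Derivation 𝕜 (RatFunc 𝕜) (RatFunc 𝕜) := fracDer (RatFunc 𝕜) Polynomial.derivative'

/-- `B_X^rat = PsiDO(𝕜(z), ∂_z)_{≤ 0}` for the vector field `X = ∂_z`. -/
abbrev BRat : Type _ := PsiDO (ratDer 𝕜)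

/-- Fixes the coefficientwise `𝕜`-algebra structure on `𝕜((t))`. -/
instance (priority := 2000) laurentAlgebra : Algebra 𝕜 𝕜⸨X⸩ := HahnSeries.instAlgebra

instance laurentScalarTower : IsScalarTower 𝕜 𝕜⟦X⟧ 𝕜⸨X⸩ :=
  IsScalarTower.of_algebraMap_eq (R := 𝕜) (S := 𝕜⟦X⟧) (A := 𝕜⸨X⸩) fun c => by
    rw [LaurentSeries.coe_algebraMap]
    exact (HahnSeries.ofPowerSeries_C c).symm

/-- The derivation `d/dt` of the local field `𝕜((t))`. -/
def laurentDer : Derivation 𝕜 𝕜⸨X⸩ 𝕜⸨X⸩ := fracDer 𝕜⸨X⸩ (PowerSeries.derivative 𝕜)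

/-- The variable `t` of `𝕜((t))`. -/
def tLaurent : 𝕜⸨X⸩ := algebraMap 𝕜⟦X⟧ 𝕜⸨X⸩ PowerSeries.X

variable {𝕜}

/-- The expansion of the coordinate `z` at a point `P` of the projective line `𝕜 ∪ {∞}`, in terms
of the local coordinate `t` at `P`: `t = z - c` at a finite point `c`, and `t = 1/z` at `∞`. -/
def zAt (P : OnePoint 𝕜) : 𝕜⸨X⸩ :=
  OnePoint.elim P (tLaurent 𝕜)⁻¹ fun c => algebraMap 𝕜 𝕜⸨X⸩ c + tLaurent 𝕜

theorem tLaurent_ne_zero : tLaurent 𝕜 ≠ 0 := by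
  rw [tLaurent, Ne, map_eq_zero_iff _ (IsFractionRing.injective 𝕜⟦X⟧ 𝕜⸨X⸩)]
  exact PowerSeries.X_ne_zero

theorem laurentDer_tLaurent : laurentDer 𝕜 (tLaurent 𝕜) = 1 := by
  rw [laurentDer, tLaurent, fracDer_algebraMap, PowerSeries.derivative_X, map_one]

theorem laurentDer_zAt_ne_zero (P : OnePoint 𝕜) : laurentDer 𝕜 (zAt P) ≠ 0 := by
  induction P using OnePoint.rec with
  | infty =>
    change laurentDer 𝕜 (tLaurent 𝕜)⁻¹ ≠ 0
    rw [Derivation.leibniz_inv, laurentDer_tLaurent]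
    simp [tLaurent_ne_zero]
  | coe c =>
    change laurentDer 𝕜 (algebraMap 𝕜 𝕜⸨X⸩ c + tLaurent 𝕜) ≠ 0
    rw [map_add, laurentDer_tLaurent, Derivation.map_algebraMap, zero_add]
    exact one_ne_zero

variable [IsAlgClosed 𝕜]

theorem aeval_zAt_ne_zero (P : OnePoint 𝕜) {p : 𝕜[X]} (hp : p ≠ 0) :
    Polynomial.aeval (zAt P) p ≠ 0 := by
  intro h
  have hint : IsAlgebraic 𝕜 (zAt P) := ⟨p, hp, h⟩
  have hcoe : ∀ c : 𝕜, algebraMap 𝕜 𝕜⸨X⸩ c ≠ zAt P := by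
    intro c hc
    apply laurentDer_zAt_ne_zero P
    rw [← hc, Derivation.map_algebraMap]
  have hdeg := IsAlgClosed.degree_eq_one_of_irreducible 𝕜 (minpoly.irreducible hint.isIntegral)
  obtain ⟨c, hc⟩ := minpoly.mem_range_of_degree_eq_one 𝕜 (zAt P) hdeg
  exact hcoe c hc

theorem aeval_zAt_nonZeroDivisors (P : OnePoint 𝕜) :
    nonZeroDivisors 𝕜[X] ≤
      (nonZeroDivisors 𝕜⸨X⸩).comap (Polynomial.aeval (zAt P) : 𝕜[X] →ₐ[𝕜] 𝕜⸨X⸩) := fun _ hp =>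
  mem_nonZeroDivisors_of_ne_zero (aeval_zAt_ne_zero P (nonZeroDivisors.ne_zero hp))

/-- The Laurent expansion `ℓ_P : 𝕜(z) → 𝕜((t))` at the point `P`. -/
def expansion (P : OnePoint 𝕜) : RatFunc 𝕜 →ₐ[𝕜] 𝕜⸨X⸩ :=
  RatFunc.liftAlgHom (Polynomial.aeval (zAt P)) (aeval_zAt_nonZeroDivisors P)

theorem expansion_algebraMap (P : OnePoint 𝕜) (p : 𝕜[X]) :
    expansion P (algebraMap 𝕜[X] (RatFunc 𝕜) p) = Polynomial.aeval (zAt P) p := by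
  have h := RatFunc.liftAlgHom_apply_div (φ := Polynomial.aeval (zAt P))
    (aeval_zAt_nonZeroDivisors P) p 1
  rw [map_one, div_one, map_one, div_one] at h
  exact h

/-- The expansion at `P` of the vector field `∂_z`: the derivation `X(t) d/dt` of `𝕜((t))` with
`X(t) = (dz/dt)⁻¹`. So `X(t) = 1` at finite points and `X(t) = -t ^ 2` at `∞`. -/
def vectorFieldAt (P : OnePoint 𝕜) : Derivation 𝕜 𝕜⸨X⸩ 𝕜⸨X⸩ :=
  (laurentDer 𝕜 (zAt P))⁻¹ • laurentDer 𝕜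

theorem expansion_ratDer (P : OnePoint 𝕜) (f : RatFunc 𝕜) :
    vectorFieldAt P (expansion P f) = expansion P (ratDer 𝕜 f) := by
  have hder : ∀ p : 𝕜[X], vectorFieldAt P (expansion P (algebraMap 𝕜[X] (RatFunc 𝕜) p)) =
      expansion P (ratDer 𝕜 (algebraMap 𝕜[X] (RatFunc 𝕜) p)) := fun p => by
    rw [expansion_algebraMap, ratDer, fracDer_algebraMap, expansion_algebraMap, Derivation.map_aeval]
    change _ * ((laurentDer 𝕜 (zAt P))⁻¹ * laurentDer 𝕜 (zAt P)) = _
    rw [inv_mul_cancel₀ (laurentDer_zAt_ne_zero P), mul_one]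
    rfl
  obtain ⟨p, q, _, rfl⟩ := IsFractionRing.div_surjective 𝕜[X] f
  simp only [map_div₀, Derivation.leibniz_div, hder, smul_eq_mul, map_mul, map_sub, map_pow,
    map_inv₀]

/-- The Laurent expansion `L_P : B_X^rat → PsiDO(𝕜((t)), d/dt)_{≤ 0}` at `P`: the morphism induced by
`ℓ_P`, followed by the change of derivation from `X(t) d/dt` to `d/dt`. -/
def laurentExpansion (P : OnePoint 𝕜) : BRat 𝕜 →ₐ[𝕜] PsiDO (laurentDer 𝕜) :=
  (PsiDO.changeDer (vectorFieldAt P) (laurentDer 𝕜) (laurentDer 𝕜 (zAt P)) fun a => by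
    change _ = _ * ((laurentDer 𝕜 (zAt P))⁻¹ * _)
    rw [mul_inv_cancel_left₀ (laurentDer_zAt_ne_zero P)]; rfl).comp
  (PsiDO.map (expansion P) (expansion_ratDer P))

end ProjectiveLine

section Regular

variable (𝕜 : Type*) [Field 𝕜]

/-- The derivation `t^δ d/dt` of `𝕜[[t]]`. -/
def powerDer (δ : ℕ) : Derivation 𝕜 𝕜⟦X⟧ 𝕜⟦X⟧ :=
  (PowerSeries.X ^ δ : 𝕜⟦X⟧) • PowerSeries.derivative 𝕜

/-- The derivation `t^δ d/dt` of `𝕜((t))`. -/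
def laurentPowerDer (δ : ℕ) : Derivation 𝕜 𝕜⸨X⸩ 𝕜⸨X⸩ := tLaurent 𝕜 ^ δ • laurentDer 𝕜

/-- `PsiDO(𝕜[[t]], t^δ d/dt)_{≤ 0}` as a subalgebra of `PsiDO(𝕜((t)), d/dt)_{≤ 0}`. -/
def regularOps (δ : ℕ) : Subalgebra 𝕜 (PsiDO (laurentDer 𝕜)) :=
  ((PsiDO.changeDer (laurentPowerDer 𝕜 δ) (laurentDer 𝕜) (tLaurent 𝕜 ^ δ)⁻¹ fun a => by
      change _ = _ * (tLaurent 𝕜 ^ δ * _)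
      rw [inv_mul_cancel_left₀ (pow_ne_zero _ tLaurent_ne_zero)]; rfl).comp
    (PsiDO.map (der := powerDer 𝕜 δ) (IsScalarTower.toAlgHom 𝕜 𝕜⟦X⟧ 𝕜⸨X⸩) fun a => by
      change tLaurent 𝕜 ^ δ * laurentDer 𝕜 (algebraMap 𝕜⟦X⟧ 𝕜⸨X⸩ a) =
        algebraMap 𝕜⟦X⟧ 𝕜⸨X⸩ (PowerSeries.X ^ δ * PowerSeries.derivative 𝕜 a)
      rw [laurentDer, fracDer_algebraMap, map_mul, map_pow, tLaurent])).range

variable [IsAlgClosed 𝕜]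

/-- The algebra `B_X^{(D)}` on the projective line, for `X = ∂_z` and the effective divisor
`D = ∑ δ_P P`: all rational operators whose expansion at each point `P` lies in
`PsiDO(𝕜[[t]], t^{δ_P} d/dt)_{≤ 0}`. -/
def BReg (D : OnePoint 𝕜 →₀ ℕ) : Subalgebra 𝕜 (BRat 𝕜) :=
  ⨅ P : OnePoint 𝕜, (regularOps 𝕜 (D P)).comap (laurentExpansion P)

/-- `B_X = B_X^{(D)}` for `D = N∞`. -/
def BX (N : ℕ) : Subalgebra 𝕜 (BRat 𝕜) := BReg 𝕜 (Finsupp.single OnePoint.infty N)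

end Regular

section Generators

variable (𝕜 : Type*) [Field 𝕜]

/-- The element `∂_z^{-1} z^a` of `B_X^rat`. -/
def omegaLift (a : ℕ) : BRat 𝕜 :=
  PsiDO.Dinv (ratDer 𝕜) * PsiDO.const (ratDer 𝕜) (RatFunc.X ^ a)

/-- The subalgebra `B'_X` of `B_X^rat` generated by the `∂_z^{-1} z^a`, `0 ≤ a ≤ N - 2`. -/
def BX' (N : ℕ) : Subalgebra 𝕜 (BRat 𝕜) :=
  Algebra.adjoin 𝕜 {x | ∃ a : ℕ, a + 2 ≤ N ∧ x = omegaLift 𝕜 a}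

/-! ## The algebra with generators `t_a` and its completion -/

/-- The relations `t_a t_b - t_c t_d = (d - b) t_a t_{b-d-1} t_d` between the generators
`t_0, …, t_{N-2}`, for `a + b = c + d` and `b > d`. -/
inductive PresRel (N : ℕ) :
    FreeAlgebra 𝕜 (Fin (N - 1)) → FreeAlgebra 𝕜 (Fin (N - 1)) → Prop
  | rel (a b c d : Fin (N - 1)) (hsum : (a : ℕ) + b = c + d) (hbd : (d : ℕ) < b) :
      PresRel N
        (FreeAlgebra.ι 𝕜 a * FreeAlgebra.ι 𝕜 b - FreeAlgebra.ι 𝕜 c * FreeAlgebra.ι 𝕜 d)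
        (((d : 𝕜) - (b : 𝕜)) • (FreeAlgebra.ι 𝕜 a *
          FreeAlgebra.ι 𝕜 (⟨(b : ℕ) - d - 1, by omega⟩ : Fin (N - 1)) * FreeAlgebra.ι 𝕜 d))

/-- The algebra `C` with generators `t_a`, `0 ≤ a ≤ N - 2`, and the above relations. -/
abbrev CAlg (N : ℕ) : Type _ := RingQuot (PresRel 𝕜 N)

/-- The generator `t_a` of `C`. -/
def tGen (N : ℕ) (a : Fin (N - 1)) : CAlg 𝕜 N :=
  RingQuot.mkAlgHom 𝕜 (PresRel 𝕜 N) (FreeAlgebra.ι 𝕜 a)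

/-- The two-sided ideal `I_C` of `C` generated by the `t_a`. -/
def augIdeal (N : ℕ) : Ideal (CAlg 𝕜 N) :=
  TwoSidedIdeal.asIdeal (TwoSidedIdeal.span (Set.range (tGen 𝕜 N)))

instance (N : ℕ) : (augIdeal 𝕜 N).IsTwoSided := by unfold augIdeal; infer_instance

/-- The completion `lim_n C / I_C^n`, as the algebra of compatible families. -/
def CHat (N : ℕ) : Subalgebra 𝕜 (∀ n : ℕ, CAlg 𝕜 N ⧸ augIdeal 𝕜 N ^ n) where
  carrier := {x | ∀ m n (h : m ≤ n),
    Ideal.Quotient.factorₐ 𝕜 (Ideal.pow_le_pow_right (I := augIdeal 𝕜 N) h) (x n) = x m}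
  mul_mem' hx hy m n h := by
    rw [Pi.mul_apply, Pi.mul_apply, map_mul, hx m n h, hy m n h]
  add_mem' hx hy m n h := by
    rw [Pi.add_apply, Pi.add_apply, map_add, hx m n h, hy m n h]
  algebraMap_mem' c m n h := by
    rw [Pi.algebraMap_apply, Pi.algebraMap_apply, AlgHom.commutes]

/-- The inverse limit topology on the completion, each `C / I_C^n` being discrete. -/
instance (N : ℕ) : TopologicalSpace (CHat 𝕜 N) :=
  ⨅ n : ℕ, TopologicalSpace.induced
    (fun x : CHat 𝕜 N => (x : ∀ n : ℕ, CAlg 𝕜 N ⧸ augIdeal 𝕜 N ^ n) n) ⊥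

/-- The canonical morphism from `C` to its completion. -/
def toCHat (N : ℕ) : CAlg 𝕜 N →ₐ[𝕜] CHat 𝕜 N :=
  AlgHom.codRestrict (AlgHom.pi fun n => Ideal.Quotient.mkₐ 𝕜 (augIdeal 𝕜 N ^ n)) (CHat 𝕜 N)
    fun _ _ _ _ => rfl

end Generators

end

noncomputable section

namespace PsiDO

/-! ### The filtration by order and its leading coefficients. -/

section Filtration

variable {k R : Type*} [CommRing k] [CommRing R] [Algebra k R] {der : Derivation k R R}

/-! Write `M = N - 2`. The argument compares two filtrations: that of `C` by the powers of `I_C`,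
and that of the operators by order. The map `realization : C → B_X^rat`, `t_a ↦ ∂_z⁻¹ z^a`, exists
because moving a power of `z` through `∂_z⁻¹` produces exactly the defining relations
(`quadratic_relation`), and it carries `I_C^n` into order `≤ -n`.

On the operator side, an element lies in `B_X` exactly when its `n`-th coefficient is a polynomial
of degree `≤ nM` (`mem_BX_iff`): regularity at the finite points excludes poles there, and the
condition at infinity bounds the degree. On the side of `C`, the right-hand sides of the relations
are cubic, so modulo `I_C^3` the product `t_a t_b` depends only on `a + b`. Hence `I_C^n /
I_C^(n+1)` is spanned by one standard monomial for each total index `s ≤ nM`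
(`exists_sub_stdMonMap_mem`), and the image of that monomial has leading coefficient `z^s`.

The spanning set thus goes to the basis `1, z, ..., z^(nM)` of the possible leading coefficients.
Linear independence of these powers gives strictness: `I_C^n` is the full preimage of the operators
of order `≤ -n` (`mem_augIdeal_pow_iff`). That the powers exhaust the possible leading coefficients
gives density of the image in `B_X` (`exists_realization_sub_mem_fil`). Together they identify the
completion with `B_X`, while strictness alone identifies the kernel of `realization` with the
intersection of the `I_C^n`. -/

theorem coeff_smul (c : k) (x : PsiDO der) (n : ℕ) : (c • x).coeff n = c • x.coeff n := by
  rw [Algebra.smul_def, algebraMap_eq, const_mul_coeff, Algebra.smul_def]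

theorem coeff_sum {ι : Type*} (s : Finset ι) (f : ι → PsiDO der) (n : ℕ) :
    (∑ i ∈ s, f i).coeff n = ∑ i ∈ s, (f i).coeff n := by
  classical
  induction s using Finset.induction_on with
  | empty => simp
  | insert i s hi ih => rw [Finset.sum_insert hi, Finset.sum_insert hi, coeff_add, ih]

/-- The operators of order at most `-n`. -/
def fil (der : Derivation k R R) (n : ℕ) : Submodule k (PsiDO der) where
  carrier := {x | ∀ i < n, x.coeff i = 0}
  add_mem' hx hy i hi := by rw [coeff_add, hx i hi, hy i hi, add_zero]
  zero_mem' _ _ := rfl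
  smul_mem' c x hx i hi := by rw [coeff_smul, hx i hi, smul_zero]

theorem mem_fil_zero (x : PsiDO der) : x ∈ fil der 0 := fun _ h => absurd h (Nat.not_lt_zero _)

theorem fil_antitone : Antitone (fil der) := fun _ _ h _ hx i hi => hx i (hi.trans_le h)

theorem mem_fil_succ {x : PsiDO der} {n : ℕ} :
    x ∈ fil der (n + 1) ↔ x ∈ fil der n ∧ x.coeff n = 0 := by
  constructor
  · exact fun h => ⟨fil_antitone n.le_succ h, h n n.lt_succ_self⟩
  · rintro ⟨h, h0⟩ i hi
    rcases Nat.lt_succ_iff_lt_or_eq.mp hi with hi | rfl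
    exacts [h i hi, h0]

theorem mul_mem_fil {x y : PsiDO der} {m n : ℕ} (hx : x ∈ fil der m) (hy : y ∈ fil der n) :
    x * y ∈ fil der (m + n) := by
  intro i hi
  rw [coeff_mul]
  refine Finset.sum_eq_zero fun p hp => Finset.sum_eq_zero fun q hq => ?_
  have h1 := Finset.HasAntidiagonal.mem_antidiagonal.mp hp
  have h2 := Finset.HasAntidiagonal.mem_antidiagonal.mp hq
  rcases lt_or_ge p.1 m with h | h
  · rw [hx _ h, zero_mul, smul_zero]
  · rw [hy q.2 (by omega), iterate_map_zero, mul_zero, smul_zero]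

/-- Every term of the product that differentiates a coefficient has lower order, so leading
coefficients multiply as functions. -/
theorem coeff_mul_of_mem_fil {x y : PsiDO der} {m n : ℕ} (hx : x ∈ fil der m)
    (hy : y ∈ fil der n) : (x * y).coeff (m + n) = x.coeff m * y.coeff n := by
  rw [coeff_mul, Finset.sum_eq_single (m, n), Finset.sum_eq_single (0, n)]
  · simp
  · rintro q hq hne
    have h2 := Finset.HasAntidiagonal.mem_antidiagonal.mp hq
    have : q.2 ≠ n := fun h => hne (Prod.ext (by simp only at h2 ⊢; omega) h)
    rw [hy q.2 (by simp only at h2; omega), iterate_map_zero, mul_zero, smul_zero]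
  · simp
  · rintro p hp hne
    have h1 := Finset.HasAntidiagonal.mem_antidiagonal.mp hp
    refine Finset.sum_eq_zero fun q hq => ?_
    have h2 := Finset.HasAntidiagonal.mem_antidiagonal.mp hq
    have hp1 : p.1 ≠ m := fun h => hne (Prod.ext h (by simp only; omega))
    rcases lt_or_ge p.1 m with h | h
    · rw [hx _ h, zero_mul, smul_zero]
    · rw [hy q.2 (by omega), iterate_map_zero, mul_zero, smul_zero]
  · simp

theorem mul_mem_fil_left (x : PsiDO der) {y : PsiDO der} {n : ℕ} (hy : y ∈ fil der n) :
    x * y ∈ fil der n := by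
  simpa using mul_mem_fil (mem_fil_zero x) hy

theorem mul_mem_fil_right {x : PsiDO der} (y : PsiDO der) {n : ℕ} (hx : x ∈ fil der n) :
    x * y ∈ fil der n := by
  simpa using mul_mem_fil hx (mem_fil_zero y)

theorem eq_zero_of_forall_mem_fil {x : PsiDO der} (h : ∀ n, x ∈ fil der n) : x = 0 := by
  ext n
  exact h (n + 1) n n.lt_succ_self

theorem eq_of_forall_sub_mem_fil {x y : PsiDO der} (h : ∀ n, x - y ∈ fil der n) : x = y :=
  sub_eq_zero.mp (eq_zero_of_forall_mem_fil h)

theorem continuous_coeff (n : ℕ) :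
    @Continuous (PsiDO der) R _ ⊥ fun x : PsiDO der => x.coeff n :=
  @continuous_iInf_dom _ _ _ _ _ ⊥ n (@continuous_induced_dom _ _ _ ⊥)

end Filtration

/-! ### The quadratic-cubic relations between the operators. -/

section Commutation

variable {k R : Type*} [CommRing k] [CommRing R] [Algebra k R] {der : Derivation k R R}

/-- The commutation relation of `D⁻¹` with powers of a function `z` such that `∂ z = 1`. -/
theorem Dinv_mul_const_pow {z : R} (hz : der z = 1) (e : ℕ) :
    Dinv der * const der (z ^ (e + 1)) = const der (z ^ (e + 1)) * Dinv der -
      ((e + 1 : ℕ) : k) • (Dinv der * const der (z ^ e) * Dinv der) := by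
  have h : const der (der (z ^ (e + 1))) = ((e + 1 : ℕ) : k) • const der (z ^ e) := by
    rw [Derivation.leibniz_pow, hz, Algebra.smul_def ((e + 1 : ℕ) : k), algebraMap_eq, map_natCast,
      smul_eq_mul, mul_one, Nat.add_sub_cancel, nsmul_eq_mul]
    exact (constHom der).map_mul _ _
  rw [Dinv_const, h, mul_smul_comm, smul_mul_assoc]

/-- With `e = b - d - 1`, factor `z^b = z^(e+1) z^d` and move `z^(e+1)` to the left through the
second `D⁻¹`. It merges with `z^a` into `z^c`, and the commutator is the cubic term with coefficient
`-(e+1) = d - b`. -/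
theorem quadratic_relation {z : R} (hz : der z = 1) {a b c d : ℕ} (hsum : a + b = c + d)
    (hbd : d < b) :
    Dinv der * const der (z ^ a) * (Dinv der * const der (z ^ b)) -
        Dinv der * const der (z ^ c) * (Dinv der * const der (z ^ d)) =
      ((d : k) - (b : k)) • (Dinv der * const der (z ^ a) *
        (Dinv der * const der (z ^ (b - d - 1))) * (Dinv der * const der (z ^ d))) := by
  obtain ⟨e, rfl⟩ : ∃ e, b = e + 1 + d := ⟨b - d - 1, by omega⟩
  obtain rfl : c = a + (e + 1) := by omega
  have hc : ∀ i j : ℕ, const der (z ^ (i + j)) = const der (z ^ i) * const der (z ^ j) :=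
    fun i j => by rw [pow_add]; exact (constHom der).map_mul _ _
  have hk : (d : k) - ((e + 1 + d : ℕ) : k) = -((e + 1 : ℕ) : k) := by push_cast; ring
  rw [show e + 1 + d - d - 1 = e by omega, hk, hc (e + 1) d, ← mul_assoc (Dinv der),
    Dinv_mul_const_pow (k := k) hz, hc a (e + 1), neg_smul]
  simp only [sub_mul, mul_sub, smul_mul_assoc, mul_smul_comm, mul_assoc]
  abel

end Commutation

/-! ### Composition of changes of derivation. -/

section ChangeDer

variable {k R : Type*} [CommRing k] [CommRing R] [Algebra k R]
  {d₁ d₂ d₃ : Derivation k R R}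

theorem changeFun_one {d : Derivation k R R} (x : PsiDO d) : changeFun d 1 x = x := by
  have hg : ∀ i n : ℕ, (gen d 1 ^ i).coeff n = if n = i then 1 else 0 := by
    intro i n
    have : gen d (1 : R) = Dinv d := mul_one _
    have hp : ∀ i : ℕ, Dinv d ^ i = shift^[i] 1 := by
      intro i
      induction i with
      | zero => rfl
      | succ i ih => rw [pow_succ', ih, Dinv_mul, Function.iterate_succ_apply']
    rw [this, hp, coeff_iterate_shift]
    exact congrFun (iterate_shiftInv_const (der := d) 1 d.map_one_eq_zero i) n
  ext n
  change ∑ i ∈ Finset.range (n + 1), x.coeff i * (gen d 1 ^ i).coeff n = _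
  rw [Finset.sum_eq_single n]
  · simp [hg]
  · intro i _ hi
    rw [hg, if_neg (Ne.symm hi), mul_zero]
  · simp

/-- The outer map is an algebra morphism sending `D⁻¹ f` to `D⁻¹ (g f)`. Only the outer map has to
be multiplicative: the inner one enters through its finite truncations. -/
theorem changeFun_changeFun {f g : R} (hg : ∀ a, d₃ a = g * d₂ a) (x : PsiDO d₁) :
    changeFun d₃ g (changeFun d₂ f x) = changeFun d₃ (g * f) x := by
  let ψ := changeDer d₂ d₃ g hg
  have hgen : ψ (gen d₂ f) = gen d₃ (g * f) := by
    have h1 : ψ (Dinv d₂) = gen d₃ g := by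
      have h := changeFun_shift g hg (1 : PsiDO d₂)
      rw [← Dinv_mul, mul_one] at h
      exact h.trans ((congrArg _ (changeFun_const g 1)).trans (mul_one _))
    rw [gen, map_mul, h1, gen, gen, mul_assoc]
    congr 1
    exact (congrArg _ (changeFun_const g f)).trans ((constHom d₃).map_mul g f).symm
  -- The `n`-th coefficient of the image involves only coefficients up to `n`, so the series may be
  -- replaced by a finite sum, on which `ψ` is computed termwise.
  have hloc : ∀ (y z : PsiDO d₂) (n : ℕ), (∀ i < n + 1, y.coeff i = z.coeff i) →
      (ψ y).coeff n = (ψ z).coeff n := by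
    intro y z n h
    change ∑ i ∈ Finset.range (n + 1), _ = ∑ i ∈ Finset.range (n + 1), _
    exact Finset.sum_congr rfl fun i hi => by rw [h i (Finset.mem_range.mp hi)]
  ext n
  have h := hloc (changeFun d₂ f x)
    (∑ i ∈ Finset.range (n + 1), const d₂ (x.coeff i) * gen d₂ f ^ i) n
    fun i hi => changeFun_coeff f x hi
  refine h.trans ?_
  rw [changeFun_coeff (g * f) x n.lt_succ_self, map_sum]
  congr 1
  refine Finset.sum_congr rfl fun i _ => ?_
  rw [map_mul, map_pow, hgen]
  congr 1
  exact changeFun_const g _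

end ChangeDer

/-! ### Regularity of coefficients under a change of derivation. -/

section Regularity

variable {k R : Type*} [CommRing k] [CommRing R] [Algebra k R] {der d : Derivation k R R}

theorem gen_mem_fil (f : R) (i : ℕ) : gen d f ^ i ∈ fil d i := fun _ h => coeff_gen_pow f h

theorem coeff_gen_pow_self (f : R) (i : ℕ) : (gen d f ^ i).coeff i = f ^ i := by
  induction i with
  | zero => simp [coeff_one]
  | succ i ih =>
    rw [pow_succ, coeff_mul_of_mem_fil (gen_mem_fil f i) (by simpa using gen_mem_fil f 1), ih,
      gen, Dinv_mul, pow_succ]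
    simp [shift, shiftInv, coeff_const]

/-- Since `d f = f g`, the derivative of `f^(i+1) a` is `f^(i+1) (d a + (i+1) g a)`; the factor
`f^(i+1)` therefore survives the recursion defining left multiplication by `D⁻¹`. -/
theorem coeff_gen_pow_eq_mul {A : Subring R} (hA : ∀ a ∈ A, d a ∈ A) {f : R}
    (hf : ∃ g ∈ A, d f = f * g) (i n : ℕ) : ∃ a ∈ A, (gen d f ^ i).coeff n = f ^ i * a := by
  induction i generalizing n with
  | zero =>
    refine ⟨if n = 0 then 1 else 0, ?_, by simp [coeff_one]⟩
    split_ifs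
    exacts [A.one_mem, A.zero_mem]
  | succ i ih =>
    obtain ⟨g, hg, hfg⟩ := hf
    rw [pow_succ', gen, mul_assoc, Dinv_mul, ← gen]
    induction n with
    | zero => exact ⟨0, A.zero_mem, by simp [shift, shiftInv]⟩
    | succ n ihn =>
      obtain ⟨a, ha, hn⟩ := ihn
      obtain ⟨b, hb, hin⟩ := ih n
      refine ⟨b - (d a + ((i + 1 : ℕ) : R) * (g * a)), A.sub_mem hb (A.add_mem (hA a ha)
        (A.mul_mem (natCast_mem A _) (A.mul_mem hg ha))), ?_⟩
      change shiftInv d _ n = _ at hn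
      change shiftInv d _ (n + 1) = _
      rw [shiftInv, hn, const_mul_coeff, hin, Derivation.leibniz, Derivation.leibniz_pow, hfg]
      simp only [smul_eq_mul, nsmul_eq_mul, Nat.add_sub_cancel]
      ring

/-- The change of derivation is triangular: the new `n`-th coefficient is `x_n f^n` plus
`A`-multiples of the `x_i f^i` with `i < n`. -/
theorem coeff_changeFun_mem_iff {A : Subring R} (hA : ∀ a ∈ A, d a ∈ A) {f : R}
    (hf : ∃ g ∈ A, d f = f * g) (x : PsiDO der) :
    (∀ n, (changeFun d f x).coeff n ∈ A) ↔ ∀ n, x.coeff n * f ^ n ∈ A := by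
  have hlow : ∀ i n, x.coeff i * f ^ i ∈ A → x.coeff i * (gen d f ^ i).coeff n ∈ A := by
    intro i n h
    obtain ⟨a, ha, e⟩ := coeff_gen_pow_eq_mul hA hf i n
    rw [e, ← mul_assoc]
    exact A.mul_mem h ha
  constructor
  · intro h n
    induction n using Nat.strong_induction_on with
    | _ n ih =>
      have hn := h n
      change ∑ i ∈ Finset.range (n + 1), x.coeff i * (gen d f ^ i).coeff n ∈ A at hn
      rw [Finset.sum_range_succ, coeff_gen_pow_self] at hn
      exact (A.add_mem_cancel_left
        (A.sum_mem fun i hi => hlow i n (ih i (Finset.mem_range.mp hi)))).mp hn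
  · intro h n
    change ∑ i ∈ Finset.range (n + 1), x.coeff i * (gen d f ^ i).coeff n ∈ A
    exact A.sum_mem fun i _ => hlow i n (h i)

end Regularity

end PsiDO

/-! ### The local conditions at the points of the projective line. -/

section LocalConditions

variable (𝕜 : Type*) [Field 𝕜]

/-- The ring `𝕜[[t]]` inside `𝕜((t))`. -/
def integerRing : Subring 𝕜⸨X⸩ := (algebraMap 𝕜⟦X⟧ 𝕜⸨X⸩).range

variable {𝕜}

theorem laurentPowerDer_algebraMap (δ : ℕ) (a : 𝕜⟦X⟧) :
    laurentPowerDer 𝕜 δ (algebraMap 𝕜⟦X⟧ 𝕜⸨X⸩ a) = algebraMap 𝕜⟦X⟧ 𝕜⸨X⸩ (powerDer 𝕜 δ a) := by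
  change tLaurent 𝕜 ^ δ * laurentDer 𝕜 (algebraMap 𝕜⟦X⟧ 𝕜⸨X⸩ a) =
    algebraMap 𝕜⟦X⟧ 𝕜⸨X⸩ (PowerSeries.X ^ δ * PowerSeries.derivative 𝕜 a)
  rw [laurentDer, fracDer_algebraMap, map_mul, map_pow, tLaurent]

theorem laurentPowerDer_mem (δ : ℕ) :
    ∀ a ∈ integerRing 𝕜, laurentPowerDer 𝕜 δ a ∈ integerRing 𝕜 := by
  rintro _ ⟨a, rfl⟩
  exact ⟨_, (laurentPowerDer_algebraMap δ a).symm⟩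

/-- The changes of derivation with factors `t^δ` and `t^(-δ)` are mutually inverse, so membership
can be read off the coefficients with respect to `t^δ d/dt`. -/
theorem mem_regularOps_iff {δ : ℕ} {y : PsiDO (laurentDer 𝕜)} :
    y ∈ regularOps 𝕜 δ ↔ ∀ n, (PsiDO.changeFun (laurentPowerDer 𝕜 δ) (tLaurent 𝕜 ^ δ) y).coeff n ∈
      integerRing 𝕜 := by
  have h0 : tLaurent 𝕜 ^ δ ≠ 0 := pow_ne_zero _ tLaurent_ne_zero
  constructor
  · rintro ⟨x, rfl⟩ n
    have h : PsiDO.changeFun (laurentPowerDer 𝕜 δ) (tLaurent 𝕜 ^ δ)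
        (PsiDO.changeFun (laurentDer 𝕜) (tLaurent 𝕜 ^ δ)⁻¹
          (⟨fun n => algebraMap 𝕜⟦X⟧ 𝕜⸨X⸩ (x.coeff n)⟩ : PsiDO (laurentPowerDer 𝕜 δ))) =
          ⟨fun n => algebraMap 𝕜⟦X⟧ 𝕜⸨X⸩ (x.coeff n)⟩ := by
      rw [PsiDO.changeFun_changeFun fun _ => rfl, mul_inv_cancel₀ h0, PsiDO.changeFun_one]
    exact ⟨x.coeff n, congrArg (fun z => PsiDO.coeff z n) h.symm⟩
  · intro h
    choose x hx using h
    refine ⟨⟨x⟩, ?_⟩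
    change PsiDO.changeFun (laurentDer 𝕜) (tLaurent 𝕜 ^ δ)⁻¹
      (⟨fun n => algebraMap 𝕜⟦X⟧ 𝕜⸨X⸩ (x n)⟩ : PsiDO (laurentPowerDer 𝕜 δ)) = y
    have e : (⟨fun n => algebraMap 𝕜⟦X⟧ 𝕜⸨X⸩ (x n)⟩ : PsiDO (laurentPowerDer 𝕜 δ)) =
        PsiDO.changeFun (laurentPowerDer 𝕜 δ) (tLaurent 𝕜 ^ δ) y := by
      exact PsiDO.ext (funext hx)
    rw [e, PsiDO.changeFun_changeFun, inv_mul_cancel₀ h0, PsiDO.changeFun_one]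
    intro a
    change _ = _ * (tLaurent 𝕜 ^ δ * _)
    rw [inv_mul_cancel_left₀ h0]
    rfl

/-- Passing from `X(t) d/dt` to `d/dt` and then to `t^δ d/dt` is a single change with factor `t^δ
dz/dt`. The hypothesis says that the logarithmic derivative of this factor is regular, as the
triangularity argument requires. -/
theorem laurentExpansion_mem_regularOps_iff [IsAlgClosed 𝕜] {δ : ℕ} {P : OnePoint 𝕜}
    (hf : ∃ g ∈ integerRing 𝕜,
      laurentPowerDer 𝕜 δ (tLaurent 𝕜 ^ δ * laurentDer 𝕜 (zAt P)) =
        tLaurent 𝕜 ^ δ * laurentDer 𝕜 (zAt P) * g) (x : BRat 𝕜) :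
    laurentExpansion P x ∈ regularOps 𝕜 δ ↔
      ∀ n, expansion P (x.coeff n) * (tLaurent 𝕜 ^ δ * laurentDer 𝕜 (zAt P)) ^ n ∈
        integerRing 𝕜 := by
  rw [mem_regularOps_iff]
  have e : PsiDO.changeFun (laurentPowerDer 𝕜 δ) (tLaurent 𝕜 ^ δ) (laurentExpansion P x) =
      PsiDO.changeFun (laurentPowerDer 𝕜 δ) (tLaurent 𝕜 ^ δ * laurentDer 𝕜 (zAt P))
        (PsiDO.map (expansion P) (expansion_ratDer P) x) :=
    PsiDO.changeFun_changeFun (fun _ => rfl) _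
  rw [e, PsiDO.coeff_changeFun_mem_iff (laurentPowerDer_mem δ) hf]
  rfl

variable [IsAlgClosed 𝕜]

theorem laurentExpansion_coe_mem_iff (c : 𝕜) (x : BRat 𝕜) :
    laurentExpansion (c : OnePoint 𝕜) x ∈ regularOps 𝕜 0 ↔
      ∀ n, expansion (c : OnePoint 𝕜) (x.coeff n) ∈ integerRing 𝕜 := by
  have h1 : tLaurent 𝕜 ^ 0 * laurentDer 𝕜 (zAt (c : OnePoint 𝕜)) = 1 := by
    change tLaurent 𝕜 ^ 0 * laurentDer 𝕜 (algebraMap 𝕜 𝕜⸨X⸩ c + tLaurent 𝕜) = 1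
    rw [map_add, laurentDer_tLaurent, Derivation.map_algebraMap, zero_add, pow_zero, one_mul]
  rw [laurentExpansion_mem_regularOps_iff]
  · simp only [h1, one_pow, mul_one]
  · rw [h1]
    exact ⟨0, zero_mem _, by rw [Derivation.map_one_eq_zero, mul_zero]⟩

theorem laurentExpansion_infty_mem_iff (M : ℕ) (x : BRat 𝕜) :
    laurentExpansion OnePoint.infty x ∈ regularOps 𝕜 (M + 2) ↔
      ∀ n, expansion OnePoint.infty (x.coeff n) * tLaurent 𝕜 ^ (n * M) ∈ integerRing 𝕜 := by
  -- At infinity `z = 1/t`, so `dz/dt = -t^(-2)`; the order `M + 2` of the divisor leaves `t^M` up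
  -- to sign.
  have h1 : tLaurent 𝕜 ^ (M + 2) * laurentDer 𝕜 (zAt OnePoint.infty) = -tLaurent 𝕜 ^ M := by
    change tLaurent 𝕜 ^ (M + 2) * laurentDer 𝕜 (tLaurent 𝕜)⁻¹ = _
    have h0 : tLaurent 𝕜 ≠ 0 := tLaurent_ne_zero
    rw [Derivation.leibniz_inv, laurentDer_tLaurent, smul_eq_mul, mul_one, pow_add]
    field_simp
  have ht : tLaurent 𝕜 ∈ integerRing 𝕜 := ⟨_, rfl⟩
  rw [laurentExpansion_mem_regularOps_iff]
  · refine forall_congr' fun n => ?_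
    rw [h1, neg_pow, mul_comm n M, pow_mul]
    rcases neg_one_pow_eq_or 𝕜⸨X⸩ n with h | h <;> simp [h]
  · rw [h1]
    refine ⟨(M : 𝕜⸨X⸩) * tLaurent 𝕜 ^ (M + 1), mul_mem (natCast_mem _ _) (pow_mem ht _), ?_⟩
    change tLaurent 𝕜 ^ (M + 2) * laurentDer 𝕜 (-tLaurent 𝕜 ^ M) = _
    rw [map_neg, Derivation.leibniz_pow, laurentDer_tLaurent]
    rcases M with _ | M
    · simp
    · simp only [smul_eq_mul, nsmul_eq_mul, Nat.add_sub_cancel]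
      ring

end LocalConditions

/-! ### Global description of `B_X` by polynomial coefficients. -/

section Coefficients

variable {𝕜 : Type*} [Field 𝕜]

theorem constantCoeff_aeval (c : 𝕜) (p : 𝕜[X]) :
    PowerSeries.constantCoeff
      (Polynomial.aeval (algebraMap 𝕜 𝕜⟦X⟧ c + PowerSeries.X) p) = p.eval c := by
  rw [Polynomial.aeval_def, Polynomial.hom_eval₂]
  have : (PowerSeries.constantCoeff (R := 𝕜)).comp (algebraMap 𝕜 𝕜⟦X⟧) = RingHom.id 𝕜 := by
    ext a; simp
  rw [this, Polynomial.eval]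
  congr 1
  simp

variable [IsAlgClosed 𝕜]

theorem expansion_coe_algebraMap (c : 𝕜) (p : 𝕜[X]) :
    expansion (c : OnePoint 𝕜) (algebraMap 𝕜[X] (RatFunc 𝕜) p) =
      algebraMap 𝕜⟦X⟧ 𝕜⸨X⸩ (Polynomial.aeval (algebraMap 𝕜 𝕜⟦X⟧ c + PowerSeries.X) p) := by
  rw [expansion_algebraMap]
  change Polynomial.aeval (algebraMap 𝕜 𝕜⸨X⸩ c + tLaurent 𝕜) p = _
  rw [← Polynomial.aeval_algebraMap_apply, map_add, ← IsScalarTower.algebraMap_apply]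
  rfl

/-- At a root of the denominator, regularity would force the numerator to vanish too, against
coprimality. Over an algebraically closed field a denominator without roots is constant. -/
theorem forall_expansion_mem_iff (f : RatFunc 𝕜) :
    (∀ c : 𝕜, expansion (c : OnePoint 𝕜) f ∈ integerRing 𝕜) ↔
      ∃ p : 𝕜[X], f = algebraMap 𝕜[X] (RatFunc 𝕜) p := by
  constructor
  · intro h
    have hroot : ∀ c : 𝕜, ¬ f.denom.IsRoot c := by
      intro c hc
      obtain ⟨g, hg⟩ := h c
      have e : f * algebraMap 𝕜[X] (RatFunc 𝕜) f.denom = algebraMap 𝕜[X] (RatFunc 𝕜) f.num := by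
        have h0 : algebraMap 𝕜[X] (RatFunc 𝕜) f.denom ≠ 0 := by simpa using f.denom_ne_zero
        exact (div_eq_iff h0).mp (RatFunc.num_div_denom f) |>.symm
      have e2 := congrArg (expansion (c : OnePoint 𝕜)) e
      rw [map_mul, ← hg, expansion_coe_algebraMap, expansion_coe_algebraMap, ← map_mul] at e2
      have e3 := congrArg PowerSeries.constantCoeff (IsFractionRing.injective 𝕜⟦X⟧ 𝕜⸨X⸩ e2)
      rw [map_mul, constantCoeff_aeval, constantCoeff_aeval, hc, mul_zero] at e3
      exact Polynomial.not_isRoot_C (1 : 𝕜) c one_ne_zero (by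
        obtain ⟨u, v, huv⟩ := f.isCoprime_num_denom
        rw [map_one, ← huv]
        simp [Polynomial.IsRoot, ← e3, hc.eq_zero])
    have hdeg : f.denom.degree = 0 := by
      by_contra hne
      obtain ⟨c, hc⟩ := IsAlgClosed.exists_root f.denom hne
      exact hroot c hc
    have h1 : f.denom = 1 :=
      Polynomial.eq_one_of_monic_natDegree_zero f.monic_denom
        (Polynomial.natDegree_eq_zero_iff_degree_le_zero.mpr hdeg.le)
    refine ⟨f.num, ?_⟩
    conv_lhs => rw [← RatFunc.num_div_denom f, h1, map_one, div_one]
  · rintro ⟨p, rfl⟩ c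
    exact ⟨_, (expansion_coe_algebraMap c p).symm⟩

theorem expansion_infty_algebraMap_mul (p : 𝕜[X]) :
    expansion OnePoint.infty (algebraMap 𝕜[X] (RatFunc 𝕜) p) * tLaurent 𝕜 ^ p.natDegree =
      algebraMap 𝕜⟦X⟧ 𝕜⸨X⸩ (p.reverse : 𝕜⟦X⟧) := by
  rw [expansion_algebraMap]
  change Polynomial.aeval (tLaurent 𝕜)⁻¹ p * _ = _
  have h0 : tLaurent 𝕜 ≠ 0 := tLaurent_ne_zero
  let _ : Invertible (tLaurent 𝕜)⁻¹ := invertibleOfNonzero (inv_ne_zero h0)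
  have h := Polynomial.eval₂_reverse_mul_pow (algebraMap 𝕜 𝕜⸨X⸩) (tLaurent 𝕜)⁻¹ p
  rw [invOf_eq_inv, inv_inv] at h
  rw [Polynomial.aeval_def, ← h, mul_assoc, ← mul_pow, inv_mul_cancel₀ h0, one_pow, mul_one,
    ← Polynomial.aeval_def, tLaurent, Polynomial.aeval_algebraMap_apply]
  congr 1
  induction p.reverse using Polynomial.induction_on' with
  | add p q hp hq => rw [map_add, hp, hq, Polynomial.coe_add]
  | monomial n a =>
    rw [Polynomial.aeval_monomial, Polynomial.coe_monomial, PowerSeries.X_pow_eq,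
      ← Algebra.smul_def, ← map_smul, smul_eq_mul, mul_one]

/-- After multiplication by `t^(deg p)` the expansion is the reversed polynomial, whose constant
term is the leading coefficient of `p`. For `p ≠ 0` the pole order at infinity is thus exactly the
degree. -/
theorem expansion_infty_mul_mem_iff (p : 𝕜[X]) (m : ℕ) :
    expansion OnePoint.infty (algebraMap 𝕜[X] (RatFunc 𝕜) p) * tLaurent 𝕜 ^ m ∈ integerRing 𝕜 ↔
      p.natDegree ≤ m := by
  have h := expansion_infty_algebraMap_mul p
  constructor
  · rintro ⟨g, hg⟩
    by_contra! hlt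
    obtain ⟨e, he⟩ := Nat.exists_eq_add_of_lt hlt
    rw [he, add_assoc, pow_add, ← mul_assoc, ← hg, tLaurent, ← map_pow, ← map_mul] at h
    have h2 := congrArg PowerSeries.constantCoeff (IsFractionRing.injective 𝕜⟦X⟧ 𝕜⸨X⸩ h)
    have hp : p ≠ 0 := by rintro rfl; simp at hlt
    exact hp (Polynomial.leadingCoeff_eq_zero.mp (by simpa using h2.symm))
  · intro hle
    obtain ⟨e, rfl⟩ := Nat.exists_eq_add_of_le hle
    rw [pow_add, ← mul_assoc, h]
    exact (integerRing 𝕜).mul_mem ⟨_, rfl⟩ ((integerRing 𝕜).pow_mem ⟨_, rfl⟩ _)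

theorem mem_BX_iff {M : ℕ} {x : BRat 𝕜} :
    x ∈ BX 𝕜 (M + 2) ↔ ∀ n, ∃ p : 𝕜[X], p.natDegree ≤ n * M ∧
      x.coeff n = algebraMap 𝕜[X] (RatFunc 𝕜) p := by
  have h : x ∈ BX 𝕜 (M + 2) ↔ laurentExpansion OnePoint.infty x ∈ regularOps 𝕜 (M + 2) ∧
      ∀ c : 𝕜, laurentExpansion (c : OnePoint 𝕜) x ∈ regularOps 𝕜 0 := by
    simp only [BX, BReg, Algebra.mem_iInf, Subalgebra.mem_comap, OnePoint.forall]
    simp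
  simp only [h, laurentExpansion_infty_mem_iff, laurentExpansion_coe_mem_iff]
  constructor
  · rintro ⟨hinf, hfin⟩ n
    obtain ⟨p, hp⟩ := (forall_expansion_mem_iff (x.coeff n)).mp fun c => hfin c n
    have := hinf n
    rw [hp, expansion_infty_mul_mem_iff] at this
    exact ⟨p, this, hp⟩
  · intro h
    refine ⟨fun n => ?_, fun c n => ?_⟩
    · obtain ⟨p, hp, e⟩ := h n
      rw [e]
      exact (expansion_infty_mul_mem_iff p _).mpr hp
    · obtain ⟨p, -, e⟩ := h n
      exact (forall_expansion_mem_iff _).mpr ⟨p, e⟩ c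

end Coefficients

/-! ### Spanning the graded pieces of `C` by standard monomials. -/

section Presentation

variable (𝕜 : Type*) [Field 𝕜] (M : ℕ)

/-- The generator `t_s`, with indices `s ≥ M` truncated to `M`. -/
def truncGen (s : ℕ) : CAlg 𝕜 (M + 2) :=
  tGen 𝕜 (M + 2) ⟨min s M, by omega⟩

/-- The standard monomial of length `n` and total index `s`. -/
def stdMon : ℕ → ℕ → CAlg 𝕜 (M + 2)
  | 0, _ => 1
  | n + 1, s => truncGen 𝕜 M s * stdMon n (s - min s M)

theorem tGen_eq_truncGen (a : Fin (M + 2 - 1)) : tGen 𝕜 (M + 2) a = truncGen 𝕜 M a := by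
  rw [truncGen]
  congr 1
  ext
  simp only
  omega

theorem tGen_mem_augIdeal (N : ℕ) (a : Fin (N - 1)) : tGen 𝕜 N a ∈ augIdeal 𝕜 N :=
  TwoSidedIdeal.mem_asIdeal.mpr (TwoSidedIdeal.subset_span ⟨a, rfl⟩)

theorem truncGen_mem (s : ℕ) : truncGen 𝕜 M s ∈ augIdeal 𝕜 (M + 2) := tGen_mem_augIdeal _ _ _

variable {𝕜} in
theorem mul_mem_augIdeal_pow {N m n : ℕ} {x y : CAlg 𝕜 N} (hx : x ∈ augIdeal 𝕜 N ^ m)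
    (hy : y ∈ augIdeal 𝕜 N ^ n) : x * y ∈ augIdeal 𝕜 N ^ (m + n) := by
  rw [Ideal.IsTwoSided.pow_add]
  exact Ideal.mul_mem_mul hx hy

variable {𝕜} in
theorem mul_mem_augIdeal_pow_succ {N n : ℕ} {x y : CAlg 𝕜 N} (hx : x ∈ augIdeal 𝕜 N)
    (hy : y ∈ augIdeal 𝕜 N ^ n) : x * y ∈ augIdeal 𝕜 N ^ (n + 1) := by
  rw [Ideal.IsTwoSided.pow_succ]
  exact Ideal.mul_mem_mul hx hy

theorem stdMon_mem (n s : ℕ) : stdMon 𝕜 M n s ∈ augIdeal 𝕜 (M + 2) ^ n := by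
  induction n generalizing s with
  | zero => rw [Submodule.pow_zero, Ideal.one_eq_top]; trivial
  | succ n ih => exact mul_mem_augIdeal_pow_succ (truncGen_mem _ _ _) (ih _)

/-- For `b > d` the difference equals a cubic expression by the relations; exchanging the two pairs
covers `b < d`. -/
theorem tGen_mul_sub_mem (N : ℕ) (a b c d : Fin (N - 1)) (h : (a : ℕ) + b = c + d) :
    tGen 𝕜 N a * tGen 𝕜 N b - tGen 𝕜 N c * tGen 𝕜 N d ∈ augIdeal 𝕜 N ^ 3 := by
  have key : ∀ a b c d : Fin (N - 1), (a : ℕ) + b = c + d → (d : ℕ) < b →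
      tGen 𝕜 N a * tGen 𝕜 N b - tGen 𝕜 N c * tGen 𝕜 N d ∈ augIdeal 𝕜 N ^ 3 := by
    intro a b c d h hbd
    have e := RingQuot.mkAlgHom_rel 𝕜 (PresRel.rel (𝕜 := 𝕜) a b c d h hbd)
    simp only [map_sub, map_mul, map_smul] at e
    change tGen 𝕜 N a * tGen 𝕜 N b - tGen 𝕜 N c * tGen 𝕜 N d = _ at e
    rw [e, mul_assoc]
    refine Submodule.smul_of_tower_mem _ _ (mul_mem_augIdeal_pow_succ (tGen_mem_augIdeal _ _ _)
      (mul_mem_augIdeal_pow_succ (n := 1) (tGen_mem_augIdeal _ _ _) ?_))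
    rw [Submodule.pow_one]
    exact tGen_mem_augIdeal _ _ _
  rcases lt_trichotomy (d : ℕ) b with hbd | hbd | hbd
  · exact key a b c d h hbd
  · obtain rfl : d = b := Fin.ext hbd
    obtain rfl : a = c := Fin.ext (by omega)
    rw [sub_self]
    exact zero_mem _
  · rw [← neg_sub]
    exact neg_mem (key c d a b h.symm hbd)

/-- Standard monomials are greedy: each factor takes the largest index still available. To restore
this form, the first two factors are rebalanced at the cost of an error in `I_C^3 · I_C^n`, and
induction treats the rest. The bound on `s` ensures that no index is lost to truncation. -/
theorem truncGen_mul_stdMon {n a s : ℕ} (ha : a ≤ M) (hs : s ≤ n * M) :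
    truncGen 𝕜 M a * stdMon 𝕜 M n s - stdMon 𝕜 M (n + 1) (a + s) ∈
      augIdeal 𝕜 (M + 2) ^ (n + 2) := by
  induction n generalizing a s with
  | zero =>
    obtain rfl : s = 0 := by omega
    rw [stdMon, stdMon, stdMon, add_zero, sub_self]
    exact zero_mem _
  | succ n ih =>
    rw [Nat.succ_mul] at hs
    -- The new first index is `min (a + s) M`, and the second takes what remains of `a + min s M`.
    -- That remainder is at most `M`, so its outer `min` changes nothing.
    have hquad := tGen_mul_sub_mem 𝕜 (M + 2) ⟨min a M, by omega⟩ ⟨min s M, by omega⟩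
      ⟨min (a + s) M, by omega⟩ ⟨min (a + min s M - min (a + s) M) M, by omega⟩
      (by simp only; omega)
    have h1 := mul_mem_augIdeal_pow hquad (stdMon_mem 𝕜 M n (s - min s M))
    have h2 := mul_mem_augIdeal_pow_succ (truncGen_mem 𝕜 M (a + s))
      (ih (a := a + min s M - min (a + s) M) (s := s - min s M) (by omega) (by omega))
    rw [show 3 + n = n + 1 + 2 by omega] at h1
    convert! add_mem h1 h2 using 1
    rw [stdMon, stdMon, show a + min s M - min (a + s) M + (s - min s M) = a + s - min (a + s) M
      by omega]
    simp only [truncGen, sub_mul, mul_sub, mul_assoc]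
    abel

/-- The linear map taking `z^s` to the standard monomial of length `n` and total index `s`. -/
def stdMonMap (n : ℕ) : 𝕜[X] →ₗ[𝕜] CAlg 𝕜 (M + 2) :=
  Polynomial.lsum fun s => LinearMap.toSpanSingleton 𝕜 _ (stdMon 𝕜 M n s)

theorem stdMonMap_monomial (n s : ℕ) (c : 𝕜) :
    stdMonMap 𝕜 M n (Polynomial.monomial s c) = c • stdMon 𝕜 M n s := by
  rw [stdMonMap, Polynomial.lsum_apply, Polynomial.sum_monomial_index] <;> simp

/-- The span of the standard monomials of length `n`. -/
def stdSpan (n : ℕ) : Submodule 𝕜 (CAlg 𝕜 (M + 2)) :=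
  Submodule.span 𝕜 {x | ∃ s ≤ n * M, stdMon 𝕜 M n s = x}

variable {𝕜 M} in
theorem exists_stdMonMap_eq {n : ℕ} {x : CAlg 𝕜 (M + 2)} (hx : x ∈ stdSpan 𝕜 M n) :
    ∃ p : 𝕜[X], p.natDegree ≤ n * M ∧ stdMonMap 𝕜 M n p = x := by
  induction hx using Submodule.span_induction with
  | mem x hx =>
    obtain ⟨s, hs, rfl⟩ := hx
    exact ⟨Polynomial.monomial s 1, (Polynomial.natDegree_monomial_le _).trans hs,
      by rw [stdMonMap_monomial, one_smul]⟩
  | zero => exact ⟨0, by simp, map_zero _⟩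
  | add x y _ _ hx hy =>
    obtain ⟨p, hp, rfl⟩ := hx
    obtain ⟨q, hq, rfl⟩ := hy
    exact ⟨p + q, Polynomial.natDegree_add_le_of_degree_le hp hq, map_add _ _ _⟩
  | smul c x _ hx =>
    obtain ⟨p, hp, rfl⟩ := hx
    exact ⟨c • p, (Polynomial.natDegree_smul_le _ _).trans hp, map_smul _ _ _⟩

theorem stdMonMap_mem (n : ℕ) (p : 𝕜[X]) : stdMonMap 𝕜 M n p ∈ augIdeal 𝕜 (M + 2) ^ n := by
  rw [p.as_sum_range, map_sum]
  refine sum_mem fun s _ => ?_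
  rw [stdMonMap_monomial]
  exact Submodule.smul_of_tower_mem _ _ (stdMon_mem 𝕜 M n s)

variable {𝕜} in
-- That is, `C = 𝕜 + I_C`, which lets multiplication by arbitrary elements be replaced by scalars
-- modulo a higher power of `I_C`.
theorem exists_sub_algebraMap_mem {N : ℕ} (x : CAlg 𝕜 N) :
    ∃ c : 𝕜, x - algebraMap 𝕜 _ c ∈ augIdeal 𝕜 N := by
  obtain ⟨x, rfl⟩ := RingQuot.mkAlgHom_surjective 𝕜 (PresRel 𝕜 N) x
  induction x using FreeAlgebra.induction with
  | grade0 c => exact ⟨c, by rw [AlgHom.commutes, sub_self]; exact zero_mem _⟩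
  | grade1 a => exact ⟨0, by rw [map_zero, sub_zero]; exact tGen_mem_augIdeal 𝕜 N a⟩
  | mul x y hx hy =>
    obtain ⟨c, hc⟩ := hx
    obtain ⟨d, hd⟩ := hy
    refine ⟨c * d, ?_⟩
    rw [map_mul, map_mul]
    exact Ideal.mul_sub_mul_mem _ hc hd
  | add x y hx hy =>
    obtain ⟨c, hc⟩ := hx
    obtain ⟨d, hd⟩ := hy
    refine ⟨c + d, ?_⟩
    rw [map_add, map_add, add_sub_add_comm]
    exact add_mem hc hd

variable {𝕜 M} in
-- Multiplying an element of `I_C` on either side by `c + i`, with `c` a scalar and `i ∈ I_C`,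
-- agrees with scaling by `c` modulo `I_C^2`.
theorem mem_stdSpan_one_sup {x : CAlg 𝕜 (M + 2)} (hx : x ∈ augIdeal 𝕜 (M + 2)) :
    x ∈ stdSpan 𝕜 M 1 ⊔ (augIdeal 𝕜 (M + 2) ^ 2).restrictScalars 𝕜 := by
  have hI2 : ∀ {a b : CAlg 𝕜 (M + 2)}, a ∈ augIdeal 𝕜 (M + 2) → b ∈ augIdeal 𝕜 (M + 2) →
      a * b ∈ augIdeal 𝕜 (M + 2) ^ 2 := fun ha hb =>
    mul_mem_augIdeal_pow_succ (n := 1) ha (by rwa [Submodule.pow_one])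
  induction TwoSidedIdeal.mem_asIdeal.mp hx using TwoSidedIdeal.span_induction with
  | mem x h =>
    obtain ⟨a, rfl⟩ := h
    refine Submodule.mem_sup_left (Submodule.subset_span ⟨a, by omega, ?_⟩)
    rw [stdMon, stdMon, mul_one, tGen_eq_truncGen]
  | zero => exact zero_mem _
  | add x y hx' hy' h1 h2 => exact add_mem (h1 hx') (h2 hy')
  | neg x hx' h => exact neg_mem (h hx')
  | left_absorb a x hx' h =>
    obtain ⟨c, hc⟩ := exists_sub_algebraMap_mem a
    rw [show a * x = c • x + (a - algebraMap 𝕜 _ c) * x by rw [sub_mul, Algebra.smul_def]; abel]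
    exact add_mem (Submodule.smul_mem _ _ (h hx')) (Submodule.mem_sup_right (hI2 hc hx'))
  | right_absorb a x hx' h =>
    obtain ⟨c, hc⟩ := exists_sub_algebraMap_mem a
    rw [show x * a = c • x + x * (a - algebraMap 𝕜 _ c) by
      rw [mul_sub, Algebra.smul_def, Algebra.commutes c x]; abel]
    exact add_mem (Submodule.smul_mem _ _ (h hx')) (Submodule.mem_sup_right (hI2 hx' hc))

variable {𝕜 M} in
theorem mul_mem_stdSpan_sup {n : ℕ} {x y : CAlg 𝕜 (M + 2)} (hx : x ∈ stdSpan 𝕜 M 1)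
    (hy : y ∈ stdSpan 𝕜 M n) :
    x * y ∈ stdSpan 𝕜 M (n + 1) ⊔ (augIdeal 𝕜 (M + 2) ^ (n + 2)).restrictScalars 𝕜 := by
  have h := Submodule.mul_mem_mul hx hy
  rw [stdSpan, stdSpan, Submodule.span_mul_span] at h
  refine Submodule.span_le.mpr ?_ h
  rintro _ ⟨_, ⟨a, ha, rfl⟩, _, ⟨s, hs, rfl⟩, rfl⟩
  rw [one_mul] at ha
  have h1 := truncGen_mul_stdMon 𝕜 M ha hs
  have h2 : stdMon 𝕜 M 1 a = truncGen 𝕜 M a := by rw [stdMon, stdMon, mul_one]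
  change stdMon 𝕜 M 1 a * stdMon 𝕜 M n s ∈ _
  rw [h2, ← sub_add_cancel (truncGen 𝕜 M a * _) (stdMon 𝕜 M (n + 1) (a + s))]
  exact add_mem (Submodule.mem_sup_right h1) (Submodule.mem_sup_left (Submodule.subset_span
    ⟨_, by rw [Nat.succ_mul]; omega, rfl⟩))

variable {𝕜 M} in
-- In a product from `I_C · I_C^n`, both factors are replaced by standard representatives. The
-- errors lie in `I_C · I_C^(n+1)` and `I_C^2 · I_C^n`, both inside `I_C^(n+2)`.
theorem mem_stdSpan_sup {n : ℕ} {x : CAlg 𝕜 (M + 2)} (hx : x ∈ augIdeal 𝕜 (M + 2) ^ n) :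
    x ∈ stdSpan 𝕜 M n ⊔ (augIdeal 𝕜 (M + 2) ^ (n + 1)).restrictScalars 𝕜 := by
  induction n generalizing x with
  | zero =>
    obtain ⟨c, hc⟩ := exists_sub_algebraMap_mem x
    rw [← sub_add_cancel x (algebraMap 𝕜 _ c), Algebra.algebraMap_eq_smul_one c]
    refine add_mem (Submodule.mem_sup_right ?_) (Submodule.mem_sup_left (Submodule.smul_mem _ _
      (Submodule.subset_span ⟨0, Nat.zero_le _, rfl⟩)))
    rwa [zero_add, Submodule.pow_one, ← Algebra.algebraMap_eq_smul_one]
  | succ n ih =>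
    rw [Ideal.IsTwoSided.pow_succ, ← smul_eq_mul] at hx
    induction hx using Submodule.smul_induction_on' with
    | smul a ha b hb =>
      obtain ⟨w, hw, j, hj, rfl⟩ := Submodule.mem_sup.mp (mem_stdSpan_one_sup ha)
      obtain ⟨v, hv, i, hi, rfl⟩ := Submodule.mem_sup.mp (ih hb)
      have hw' : w ∈ augIdeal 𝕜 (M + 2) := by
        refine (Submodule.span_le (p := (augIdeal 𝕜 (M + 2)).restrictScalars 𝕜)).mpr ?_ hw
        rintro _ ⟨s, -, rfl⟩
        simpa [Submodule.pow_one] using stdMon_mem 𝕜 M 1 s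
      rw [smul_eq_mul, add_mul, mul_add, add_assoc (w * v)]
      refine add_mem (mul_mem_stdSpan_sup hw hv) (Submodule.mem_sup_right (add_mem
        (mul_mem_augIdeal_pow_succ hw' hi) ?_))
      have := mul_mem_augIdeal_pow hj hb
      rwa [add_comm 2 n] at this
    | add x _ y _ hx hy => exact add_mem hx hy

variable {𝕜 M} in
theorem exists_sub_stdMonMap_mem {n : ℕ} {x : CAlg 𝕜 (M + 2)}
    (hx : x ∈ augIdeal 𝕜 (M + 2) ^ n) :
    ∃ p : 𝕜[X], p.natDegree ≤ n * M ∧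
      x - stdMonMap 𝕜 M n p ∈ augIdeal 𝕜 (M + 2) ^ (n + 1) := by
  obtain ⟨w, hw, j, hj, rfl⟩ := Submodule.mem_sup.mp (mem_stdSpan_sup hx)
  obtain ⟨p, hp, rfl⟩ := exists_stdMonMap_eq hw
  exact ⟨p, hp, by rwa [add_sub_cancel_left]⟩

end Presentation

/-! ### The map from `C` to operators: strictness and density. -/

section Realization

variable (𝕜 : Type*) [Field 𝕜]

theorem ratDer_X : ratDer 𝕜 RatFunc.X = 1 := by
  rw [← RatFunc.algebraMap_X, ratDer, fracDer_algebraMap]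
  simp

theorem omegaLift_relation {a b c d : ℕ} (hsum : a + b = c + d) (hbd : d < b) :
    omegaLift 𝕜 a * omegaLift 𝕜 b - omegaLift 𝕜 c * omegaLift 𝕜 d =
      ((d : 𝕜) - (b : 𝕜)) • (omegaLift 𝕜 a * omegaLift 𝕜 (b - d - 1) * omegaLift 𝕜 d) :=
  PsiDO.quadratic_relation (ratDer_X 𝕜) hsum hbd

theorem omegaLift_mem_fil (a : ℕ) : omegaLift 𝕜 a ∈ PsiDO.fil (ratDer 𝕜) 1 := by
  have h := PsiDO.gen_mem_fil (d := ratDer 𝕜) (RatFunc.X ^ a) 1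
  rwa [pow_one] at h

theorem coeff_omegaLift_one (a : ℕ) : (omegaLift 𝕜 a).coeff 1 = RatFunc.X ^ a := by
  have h := PsiDO.coeff_gen_pow_self (d := ratDer 𝕜) (RatFunc.X ^ a) 1
  rwa [pow_one, pow_one] at h

/-- For `n ≥ 1` the coefficients are, up to sign, successive derivatives of `z^a`, hence of degree
at most `a ≤ n a`. -/
theorem exists_coeff_omegaLift_eq (a n : ℕ) :
    ∃ p : 𝕜[X], p.natDegree ≤ n * a ∧
      (omegaLift 𝕜 a).coeff n = algebraMap 𝕜[X] (RatFunc 𝕜) p := by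
  rcases n with _ | n
  · exact ⟨0, by simp, by rw [map_zero]; exact omegaLift_mem_fil 𝕜 a 0 one_pos⟩
  have h : ∃ p : 𝕜[X], p.natDegree ≤ a ∧
      (omegaLift 𝕜 a).coeff (n + 1) = algebraMap 𝕜[X] (RatFunc 𝕜) p := by
    induction n with
    | zero => exact ⟨Polynomial.X ^ a, by simp, by rw [coeff_omegaLift_one]; simp⟩
    | succ n ih =>
      obtain ⟨p, hp, e⟩ := ih
      refine ⟨-Polynomial.derivative p, ?_, ?_⟩
      · rw [Polynomial.natDegree_neg]
        exact (Polynomial.natDegree_derivative_le p).trans ((Nat.sub_le _ _).trans hp)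
      · rw [omegaLift, PsiDO.Dinv_mul] at e ⊢
        change PsiDO.shiftInv _ _ (n + 1) = _ at e
        change PsiDO.shiftInv _ _ (n + 1 + 1) = _
        rw [PsiDO.shiftInv, e, ratDer, fracDer_algebraMap, map_neg, PsiDO.coeff_const,
          if_neg n.succ_ne_zero, zero_sub]
        rfl
  obtain ⟨p, hp, e⟩ := h
  exact ⟨p, hp.trans (Nat.le_mul_of_pos_left _ n.succ_pos), e⟩

/-- The morphism `C → B_X^rat` taking `t_a` to `∂_z⁻¹ z^a`. -/
def realization (N : ℕ) : CAlg 𝕜 N →ₐ[𝕜] BRat 𝕜 :=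
  RingQuot.liftAlgHom 𝕜 ⟨FreeAlgebra.lift 𝕜 fun a : Fin (N - 1) => omegaLift 𝕜 a, by
    rintro _ _ ⟨a, b, c, d, hsum, hbd⟩
    simpa using omegaLift_relation 𝕜 hsum hbd⟩

theorem realization_tGen (N : ℕ) (a : Fin (N - 1)) :
    realization 𝕜 N (tGen 𝕜 N a) = omegaLift 𝕜 a := by
  rw [realization, tGen, RingQuot.liftAlgHom_mkAlgHom_apply, FreeAlgebra.lift_ι_apply]

theorem cAlg_algHom_ext {N : ℕ} {B : Type*} [Semiring B] [Algebra 𝕜 B] {f g : CAlg 𝕜 N →ₐ[𝕜] B}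
    (h : ∀ a, f (tGen 𝕜 N a) = g (tGen 𝕜 N a)) : f = g :=
  RingQuot.ringQuot_ext' 𝕜 f g (FreeAlgebra.hom_ext (funext h))

theorem adjoin_range_tGen (N : ℕ) : Algebra.adjoin 𝕜 (Set.range (tGen 𝕜 N)) = ⊤ := by
  have e : Set.range (tGen 𝕜 N) =
      RingQuot.mkAlgHom 𝕜 (PresRel 𝕜 N) '' Set.range (FreeAlgebra.ι 𝕜) := by
    rw [← Set.range_comp]; rfl
  rw [e, ← AlgHom.map_adjoin, FreeAlgebra.adjoin_range_ι, Algebra.map_top, AlgHom.range_eq_top]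
  exact RingQuot.mkAlgHom_surjective _ _

theorem realization_range (N : ℕ) : (realization 𝕜 N).range = BX' 𝕜 N := by
  rw [← Algebra.map_top, ← adjoin_range_tGen, AlgHom.map_adjoin, BX', ← Set.range_comp]
  congr 1
  ext x
  constructor
  · rintro ⟨a, rfl⟩
    exact ⟨a, by omega, realization_tGen 𝕜 N a⟩
  · rintro ⟨a, ha, rfl⟩
    exact ⟨⟨a, by omega⟩, realization_tGen 𝕜 N _⟩

theorem realization_mem_fil {N n : ℕ} {x : CAlg 𝕜 N} (hx : x ∈ augIdeal 𝕜 N ^ n) :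
    realization 𝕜 N x ∈ PsiDO.fil (ratDer 𝕜) n := by
  induction n generalizing x with
  | zero => exact PsiDO.mem_fil_zero _
  | succ n ih =>
    rw [Ideal.IsTwoSided.pow_succ, ← smul_eq_mul] at hx
    induction hx using Submodule.smul_induction_on' with
    | smul a ha b hb =>
      rw [smul_eq_mul, map_mul, add_comm]
      refine PsiDO.mul_mem_fil ?_ (ih hb)
      clear hb ih
      induction TwoSidedIdeal.mem_asIdeal.mp ha using TwoSidedIdeal.span_induction with
      | mem x h =>
        obtain ⟨i, rfl⟩ := h
        rw [realization_tGen]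
        exact omegaLift_mem_fil 𝕜 i
      | zero => rw [map_zero]; exact zero_mem _
      | add x y hx hy h1 h2 => rw [map_add]; exact add_mem (h1 hx) (h2 hy)
      | neg x hx h => rw [map_neg]; exact neg_mem (h hx)
      | left_absorb c x hx h => rw [map_mul]; exact PsiDO.mul_mem_fil_left _ (h hx)
      | right_absorb c x hx h => rw [map_mul]; exact PsiDO.mul_mem_fil_right _ (h hx)
    | add x _ y _ hx hy => rw [map_add]; exact add_mem hx hy

variable (M : ℕ)

/-- Leading coefficients multiply, and the indices of the factors add up to `s` because `s ≤ n * M`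
leaves no excess. -/
theorem coeff_realization_stdMon {n s : ℕ} (hs : s ≤ n * M) :
    (realization 𝕜 (M + 2) (stdMon 𝕜 M n s)).coeff n = RatFunc.X ^ s := by
  induction n generalizing s with
  | zero =>
    obtain rfl : s = 0 := by omega
    rw [stdMon, map_one, PsiDO.coeff_one, if_pos rfl, pow_zero]
  | succ n ih =>
    rw [Nat.succ_mul] at hs
    rw [stdMon, truncGen, map_mul, realization_tGen, add_comm n, PsiDO.coeff_mul_of_mem_fil
      (omegaLift_mem_fil 𝕜 _) (realization_mem_fil 𝕜 (stdMon_mem 𝕜 M n _)),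
      coeff_omegaLift_one, ih (by omega), ← pow_add]
    congr 1
    simp only
    omega

theorem coeff_realization_stdMonMap {n : ℕ} {p : 𝕜[X]} (hp : p.natDegree ≤ n * M) :
    (realization 𝕜 (M + 2) (stdMonMap 𝕜 M n p)).coeff n = algebraMap 𝕜[X] (RatFunc 𝕜) p := by
  conv_rhs => rw [p.as_sum_range]
  conv_lhs => rw [p.as_sum_range]
  rw [map_sum, map_sum, map_sum, PsiDO.coeff_sum]
  refine Finset.sum_congr rfl fun s hs => ?_
  have hs' := Finset.mem_range_succ_iff.mp hs
  rw [stdMonMap_monomial, map_smul, PsiDO.coeff_smul,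
    coeff_realization_stdMon 𝕜 M (hs'.trans hp), ← Polynomial.C_mul_X_pow_eq_monomial,
    ← Polynomial.smul_eq_C_mul, Algebra.smul_def, Algebra.smul_def, map_mul, map_pow,
    RatFunc.algebraMap_X, ← IsScalarTower.algebraMap_apply]

/-- Strictness, by induction: an `x ∈ I_C^n` is congruent modulo `I_C^(n+1)` to the combination of
standard monomials given by a polynomial `p`, and `p` is the `n`-th coefficient of the image. If the
image has order `≤ -(n+1)`, then `p = 0`. -/
theorem mem_augIdeal_pow_iff {n : ℕ} {x : CAlg 𝕜 (M + 2)} :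
    x ∈ augIdeal 𝕜 (M + 2) ^ n ↔ realization 𝕜 (M + 2) x ∈ PsiDO.fil (ratDer 𝕜) n := by
  refine ⟨realization_mem_fil 𝕜, ?_⟩
  induction n with
  | zero => intro; rw [Submodule.pow_zero, Ideal.one_eq_top]; trivial
  | succ n ih =>
    intro h
    obtain ⟨h1, h2⟩ := PsiDO.mem_fil_succ.mp h
    obtain ⟨p, hp, hxp⟩ := exists_sub_stdMonMap_mem (ih h1)
    have h3 := realization_mem_fil 𝕜 hxp n n.lt_succ_self
    rw [map_sub, PsiDO.coeff_sub, h2, coeff_realization_stdMonMap 𝕜 M hp, zero_sub, neg_eq_zero,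
      map_eq_zero_iff _ (RatFunc.algebraMap_injective 𝕜)] at h3
    rwa [h3, map_zero, sub_zero] at hxp

variable [IsAlgClosed 𝕜]

theorem realization_mem_BX (x : CAlg 𝕜 (M + 2)) : realization 𝕜 (M + 2) x ∈ BX 𝕜 (M + 2) := by
  have h : (realization 𝕜 (M + 2)).range ≤ BX 𝕜 (M + 2) := by
    rw [realization_range, BX', Algebra.adjoin_le_iff]
    rintro _ ⟨a, ha, rfl⟩
    refine mem_BX_iff.mpr fun n => ?_
    obtain ⟨p, hp, e⟩ := exists_coeff_omegaLift_eq 𝕜 a n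
    exact ⟨p, hp.trans (Nat.mul_le_mul_left n (by omega)), e⟩
  exact h ⟨x, rfl⟩

variable {𝕜 M} in
-- Successive approximation: the leading coefficient of the remainder is a polynomial of degree `≤
-- nM`, hence that of a combination of standard monomials, which is added to the approximant.
theorem exists_realization_sub_mem_fil {y : BRat 𝕜} (hy : y ∈ BX 𝕜 (M + 2)) (n : ℕ) :
    ∃ x, y - realization 𝕜 (M + 2) x ∈ PsiDO.fil (ratDer 𝕜) n := by
  induction n with
  | zero => exact ⟨0, PsiDO.mem_fil_zero _⟩
  | succ n ih =>
    obtain ⟨x, hx⟩ := ih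
    obtain ⟨p, hp, e⟩ := mem_BX_iff.mp (sub_mem hy (realization_mem_BX 𝕜 M x)) n
    refine ⟨x + stdMonMap 𝕜 M n p, PsiDO.mem_fil_succ.mpr ?_⟩
    rw [map_add, ← sub_sub]
    refine ⟨sub_mem hx (realization_mem_fil 𝕜 (stdMonMap_mem 𝕜 M n p)), ?_⟩
    rw [PsiDO.coeff_sub, e, coeff_realization_stdMonMap 𝕜 M hp, sub_self]

end Realization

/-! ### Extension to the completion, and uniqueness. -/

section Completion

variable {𝕜 : Type*} [Field 𝕜]

/-- A representative in `C` of the class of `x` in `C / I_C^n`. -/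
def CHat.rep {N : ℕ} (x : CHat 𝕜 N) (n : ℕ) : CAlg 𝕜 N :=
  Function.surjInv (Ideal.Quotient.mk_surjective (I := augIdeal 𝕜 N ^ n)) (x.1 n)

theorem CHat.mk_rep {N : ℕ} (x : CHat 𝕜 N) (n : ℕ) :
    Ideal.Quotient.mk (augIdeal 𝕜 N ^ n) (CHat.rep x n) = x.1 n :=
  Function.surjInv_eq _ _

theorem CHat.mk_eq_of_le {N : ℕ} {x : CHat 𝕜 N} {m n : ℕ} (h : m ≤ n) {c : CAlg 𝕜 N}
    (hc : Ideal.Quotient.mk (augIdeal 𝕜 N ^ n) c = x.1 n) :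
    Ideal.Quotient.mk (augIdeal 𝕜 N ^ m) c = x.1 m := by
  rw [← x.2 m n h, ← hc]
  rfl

theorem CHat.ext_mk {N : ℕ} {x y : CHat 𝕜 N} (h : ∀ n, x.1 n = y.1 n) : x = y :=
  Subtype.ext (funext h)

/-- The extension of `C → B_X^rat` to the completion, on underlying sets. -/
def realizationHatFun {N : ℕ} (x : CHat 𝕜 N) : BRat 𝕜 :=
  ⟨fun n => (realization 𝕜 N (CHat.rep x (n + 1))).coeff n⟩

/-- The `i`-th coefficient is determined modulo `I_C^(i+1)`, which is why the representative of
level `i + 1` defines it; any representative of level `n > i` gives the same value. -/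
theorem realizationHatFun_sub_mem {N : ℕ} {x : CHat 𝕜 N} {n : ℕ} {c : CAlg 𝕜 N}
    (hc : Ideal.Quotient.mk (augIdeal 𝕜 N ^ n) c = x.1 n) :
    realizationHatFun x - realization 𝕜 N c ∈ PsiDO.fil (ratDer 𝕜) n := by
  intro i hi
  have h1 := (CHat.mk_rep x (i + 1)).trans (CHat.mk_eq_of_le (Nat.succ_le_of_lt hi) hc).symm
  have h2 := realization_mem_fil 𝕜 (Ideal.Quotient.eq.mp h1) i i.lt_succ_self
  rwa [map_sub] at h2

/-- The value on the completion is characterized by its approximations, so each algebra axiom for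
the extension need only be checked on representatives. -/
theorem eq_realizationHatFun {N : ℕ} {x : CHat 𝕜 N} {y : BRat 𝕜}
    (h : ∀ n, ∃ c, Ideal.Quotient.mk (augIdeal 𝕜 N ^ n) c = x.1 n ∧
      y - realization 𝕜 N c ∈ PsiDO.fil (ratDer 𝕜) n) : realizationHatFun x = y := by
  refine PsiDO.eq_of_forall_sub_mem_fil fun n => ?_
  obtain ⟨c, hc, hy⟩ := h n
  rw [← sub_sub_sub_cancel_right _ _ (realization 𝕜 N c)]
  exact sub_mem (realizationHatFun_sub_mem hc) hy

theorem realizationHatFun_toCHat {N : ℕ} (c : CAlg 𝕜 N) :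
    realizationHatFun (toCHat 𝕜 N c) = realization 𝕜 N c :=
  eq_realizationHatFun fun n => ⟨c, rfl, by rw [sub_self]; exact zero_mem _⟩

variable (𝕜) in
/-- The extension of `C → B_X^rat` to the completion. -/
def realizationHat (N : ℕ) : CHat 𝕜 N →ₐ[𝕜] BRat 𝕜 where
  toFun := realizationHatFun
  map_one' := eq_realizationHatFun fun n => ⟨1, rfl, by rw [map_one, sub_self]; exact zero_mem _⟩
  map_zero' := eq_realizationHatFun fun n => ⟨0, rfl, by rw [map_zero, sub_self]; exact zero_mem _⟩
  map_add' x y := eq_realizationHatFun fun n => ⟨CHat.rep x n + CHat.rep y n, by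
    rw [map_add, CHat.mk_rep x, CHat.mk_rep y]; rfl, by
    rw [map_add, add_sub_add_comm]
    exact add_mem (realizationHatFun_sub_mem (CHat.mk_rep x n)) (realizationHatFun_sub_mem (CHat.mk_rep y n))⟩
  map_mul' x y := eq_realizationHatFun fun n => ⟨CHat.rep x n * CHat.rep y n, by
    rw [map_mul, CHat.mk_rep x, CHat.mk_rep y]; rfl, by
    -- With `X`, `Y` the values and `x'`, `y'` the approximants, `XY - x'y' = (X - x')Y + x'(Y -
    -- y')`.
    rw [map_mul, ← sub_add_sub_cancel _ (realization 𝕜 N (CHat.rep x n) * realizationHatFun y),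
      ← sub_mul, ← mul_sub]
    exact add_mem (PsiDO.mul_mem_fil_right _ (realizationHatFun_sub_mem (CHat.mk_rep x n)))
      (PsiDO.mul_mem_fil_left _ (realizationHatFun_sub_mem (CHat.mk_rep y n)))⟩
  commutes' c := eq_realizationHatFun fun n => ⟨algebraMap 𝕜 _ c, rfl, by
    rw [AlgHom.commutes, sub_self]; exact zero_mem _⟩

theorem realizationHat_toCHat {N : ℕ} (c : CAlg 𝕜 N) :
    realizationHat 𝕜 N (toCHat 𝕜 N c) = realization 𝕜 N c := realizationHatFun_toCHat c

theorem coeff_realizationHat {N : ℕ} (x : CHat 𝕜 N) (n : ℕ) :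
    (realizationHat 𝕜 N x).coeff n = (realization 𝕜 N (CHat.rep x (n + 1))).coeff n := rfl

theorem continuous_CHat_apply {N : ℕ} (n : ℕ) :
    @Continuous (CHat 𝕜 N) (CAlg 𝕜 N ⧸ augIdeal 𝕜 N ^ n) _ ⊥ fun x => x.1 n :=
  @continuous_iInf_dom _ _ _ _ _ ⊥ n (@continuous_induced_dom _ _ _ ⊥)

theorem continuous_realizationHat (N : ℕ) : Continuous (realizationHat 𝕜 N) := by
  refine continuous_iInf_rng.mpr fun n => ?_
  refine @Continuous.mk _ _ _ (TopologicalSpace.induced _ ⊥) _ ?_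
  rintro _ ⟨s, -, rfl⟩
  -- The `n`-th coefficient factors through the discrete quotient `C / I_C^(n+1)`, on which every
  -- set is open.
  have h := @IsOpen.preimage _ _ _ ⊥ _ (continuous_CHat_apply (𝕜 := 𝕜) (N := N) (n + 1))
    ((fun q => (realization 𝕜 N (Function.surjInv
      (Ideal.Quotient.mk_surjective (I := augIdeal 𝕜 N ^ (n + 1))) q)).coeff n) ⁻¹' s) trivial
  exact h

theorem nhds_of_bot {α : Type*} (a : α) : @nhds α ⊥ a = pure a :=
  @nhds_discrete α ⊥ (@DiscreteTopology.mk α ⊥ rfl) ▸ rfl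

theorem tendsto_toCHat_rep {N : ℕ} (x : CHat 𝕜 N) :
    Filter.Tendsto (fun n => toCHat 𝕜 N (CHat.rep x n)) Filter.atTop (nhds x) := by
  rw [nhds_iInf, Filter.tendsto_iInf]
  intro n
  rw [@nhds_induced _ _ ⊥, nhds_of_bot, Filter.tendsto_comap_iff, Filter.tendsto_pure]
  filter_upwards [Filter.eventually_ge_atTop n] with m hm
  exact CHat.mk_eq_of_le hm (CHat.mk_rep x m)

theorem eventually_coeff_toCHat_rep {N : ℕ} {f : CHat 𝕜 N → BRat 𝕜} (hf : Continuous f)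
    (x : CHat 𝕜 N) (n : ℕ) :
    ∀ᶠ m in Filter.atTop, (f (toCHat 𝕜 N (CHat.rep x m))).coeff n = (f x).coeff n := by
  have h1 : Filter.Tendsto (fun y : BRat 𝕜 => y.coeff n) (nhds (f x)) (pure ((f x).coeff n)) := by
    have := @Continuous.tendsto _ _ _ ⊥ _ (PsiDO.continuous_coeff (der := ratDer 𝕜) n) (f x)
    rwa [nhds_of_bot] at this
  have h2 := h1.comp ((hf.tendsto x).comp (tendsto_toCHat_rep x))
  exact Filter.tendsto_pure.mp h2

/-- Representatives of `x` converge to `x`, and each coefficient is locally constant. It therefore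
stabilizes along them, and agreement on the image of `C` suffices. -/
theorem eq_of_continuous_of_eq_toCHat {N : ℕ} {f g : CHat 𝕜 N → BRat 𝕜} (hf : Continuous f)
    (hg : Continuous g) (h : ∀ c, f (toCHat 𝕜 N c) = g (toCHat 𝕜 N c)) : f = g := by
  funext x
  ext n
  obtain ⟨m, h1, h2⟩ := ((eventually_coeff_toCHat_rep hf x n).and
    (eventually_coeff_toCHat_rep hg x n)).exists
  rw [← h1, ← h2, h]

variable (M : ℕ)

/-- If the values agree, the difference of the level-`n` representatives maps into order `≤ -n`, and
strictness puts it in `I_C^n`. -/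
theorem realizationHat_injective : Function.Injective (realizationHat 𝕜 (M + 2)) := by
  intro x y hxy
  refine CHat.ext_mk fun n => ?_
  have hx := realizationHatFun_sub_mem (CHat.mk_rep x n)
  have hy := realizationHatFun_sub_mem (CHat.mk_rep y n)
  rw [show realizationHatFun x = realizationHatFun y from hxy] at hx
  have h := sub_mem hy hx
  rw [sub_sub_sub_cancel_left, ← map_sub, ← mem_augIdeal_pow_iff] at h
  rw [← CHat.mk_rep x n, ← CHat.mk_rep y n]
  exact Ideal.Quotient.eq.mpr h

variable [IsAlgClosed 𝕜]

theorem realizationHat_mem_BX (x : CHat 𝕜 (M + 2)) :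
    realizationHat 𝕜 (M + 2) x ∈ BX 𝕜 (M + 2) :=
  mem_BX_iff.mpr fun n => by
    rw [coeff_realizationHat]
    exact mem_BX_iff.mp (realization_mem_BX 𝕜 M (CHat.rep x (n + 1))) n

/-- For `m ≤ n` the approximants of `y` differ by an element whose image has order `≤ -m`;
strictness makes their classes a compatible family. -/
theorem exists_realizationHat_eq {y : BRat 𝕜} (hy : y ∈ BX 𝕜 (M + 2)) :
    ∃ x, realizationHat 𝕜 (M + 2) x = y := by
  choose c hc using exists_realization_sub_mem_fil hy
  refine ⟨⟨fun n => Ideal.Quotient.mk _ (c n), fun m n h => ?_⟩,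
    eq_realizationHatFun (x := ⟨_, _⟩) fun n => ⟨c n, rfl, hc n⟩⟩
  refine Ideal.Quotient.eq.mpr ?_
  rw [mem_augIdeal_pow_iff, map_sub, ← sub_sub_sub_cancel_left _ _ y]
  exact sub_mem (hc m) (PsiDO.fil_antitone h (hc n))

variable (𝕜) in
/-- The isomorphism of the completion of `C` with `B_X`. -/
def completionEquiv : CHat 𝕜 (M + 2) ≃ₐ[𝕜] BX 𝕜 (M + 2) :=
  AlgEquiv.ofBijective
    ((realizationHat 𝕜 (M + 2)).codRestrict (BX 𝕜 (M + 2)) (realizationHat_mem_BX M))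
    ⟨fun _ _ h => realizationHat_injective M (congrArg Subtype.val h), fun y => by
      obtain ⟨x, hx⟩ := exists_realizationHat_eq M y.2
      exact ⟨x, Subtype.ext hx⟩⟩

theorem coe_completionEquiv (x : CHat 𝕜 (M + 2)) :
    (completionEquiv 𝕜 M x : BRat 𝕜) = realizationHat 𝕜 (M + 2) x := rfl

theorem continuous_completionEquiv : Continuous (completionEquiv 𝕜 M) :=
  continuous_induced_rng.mpr (continuous_realizationHat (M + 2))

theorem eq_completionEquiv {Φ : CHat 𝕜 (M + 2) ≃ₐ[𝕜] BX 𝕜 (M + 2)} (hc : Continuous Φ)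
    (h : ∀ a : Fin (M + 2 - 1),
      (Φ (toCHat 𝕜 (M + 2) (tGen 𝕜 (M + 2) a)) : BRat 𝕜) = omegaLift 𝕜 a) :
    Φ = completionEquiv 𝕜 M := by
  have halg : ((BX 𝕜 (M + 2)).val.comp Φ.toAlgHom).comp
      (toCHat 𝕜 (M + 2)) = realization 𝕜 (M + 2) :=
    cAlg_algHom_ext 𝕜 fun a => (h a).trans (realization_tGen 𝕜 _ a).symm
  have hfun := eq_of_continuous_of_eq_toCHat (f := fun x => (Φ x : BRat 𝕜))
    (g := realizationHat 𝕜 (M + 2)) (continuous_subtype_val.comp hc)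
    (continuous_realizationHat _) fun c => by
      rw [realizationHat_toCHat]
      exact DFunLike.congr_fun halg c
  ext x
  exact congrArg (fun y => PsiDO.coeff y _) (congrFun hfun x)

end Completion

/-! ### The separated quotient of `C`. -/

section Separation

variable (𝕜 : Type*) [Field 𝕜] (M : ℕ)

/-- By strictness, lying in every `I_C^n` means having an image of order `≤ -n` for all `n`, and
only zero has this property. -/
theorem mem_iInf_augIdeal_pow_iff {x : CAlg 𝕜 (M + 2)} :
    x ∈ (⨅ n : ℕ, augIdeal 𝕜 (M + 2) ^ n : Ideal (CAlg 𝕜 (M + 2))) ↔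
      realization 𝕜 (M + 2) x = 0 := by
  rw [Ideal.mem_iInf]
  simp only [mem_augIdeal_pow_iff]
  exact ⟨PsiDO.eq_zero_of_forall_mem_fil, fun h n => by rw [h]; exact zero_mem _⟩

/-- The isomorphism of the maximal separated quotient of `C` with `B'_X`. -/
def separatedEquiv :
    (CAlg 𝕜 (M + 2) ⧸ (⨅ n : ℕ, augIdeal 𝕜 (M + 2) ^ n : Ideal (CAlg 𝕜 (M + 2)))) ≃ₐ[𝕜]
      BX' 𝕜 (M + 2) :=
  AlgEquiv.ofBijective
    (Ideal.Quotient.liftₐ _ ((realization 𝕜 (M + 2)).codRestrict (BX' 𝕜 (M + 2)) fun x => by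
      rw [← realization_range]; exact ⟨x, rfl⟩)
      fun _ h => Subtype.ext ((mem_iInf_augIdeal_pow_iff 𝕜 M).mp h))
    ⟨by
      rw [injective_iff_map_eq_zero]
      intro q hq
      obtain ⟨x, rfl⟩ := Ideal.Quotient.mk_surjective q
      exact Ideal.Quotient.eq_zero_iff_mem.mpr
        ((mem_iInf_augIdeal_pow_iff 𝕜 M).mpr (congrArg Subtype.val hq)),
    fun y => by
      obtain ⟨x, hx⟩ := (realization_range 𝕜 (M + 2)).ge y.2
      exact ⟨Ideal.Quotient.mk _ x, Subtype.ext hx⟩⟩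

theorem coe_separatedEquiv_mk (x : CAlg 𝕜 (M + 2)) :
    (separatedEquiv 𝕜 M (Ideal.Quotient.mk _ x) : BRat 𝕜) = realization 𝕜 (M + 2) x := rfl

end Separation

end

theorem mainTheorem3 (𝕜 : Type*) [Field 𝕜] [IsAlgClosed 𝕜] [CharZero 𝕜] (N : ℕ) (hN : 2 ≤ N) :
    (∀ a b c d : ℕ, a ≤ N - 2 → b ≤ N - 2 → c ≤ N - 2 → d ≤ N - 2 → a + b = c + d → d < b →
      omegaLift 𝕜 a * omegaLift 𝕜 b - omegaLift 𝕜 c * omegaLift 𝕜 d =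
        ((d : 𝕜) - (b : 𝕜)) • (omegaLift 𝕜 a * omegaLift 𝕜 (b - d - 1) * omegaLift 𝕜 d)) ∧
    ∃ Φ : CHat 𝕜 N ≃ₐ[𝕜] BX 𝕜 N,
      (Continuous Φ ∧
        ∀ a : Fin (N - 1), (Φ (toCHat 𝕜 N (tGen 𝕜 N a)) : BRat 𝕜) = omegaLift 𝕜 a) ∧
      (∀ Φ' : CHat 𝕜 N ≃ₐ[𝕜] BX 𝕜 N,
        (Continuous Φ' ∧
          ∀ a : Fin (N - 1), (Φ' (toCHat 𝕜 N (tGen 𝕜 N a)) : BRat 𝕜) = omegaLift 𝕜 a) →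
        Φ' = Φ) ∧
      ∃ Ψ : (CAlg 𝕜 N ⧸ (⨅ n : ℕ, augIdeal 𝕜 N ^ n : Ideal (CAlg 𝕜 N))) ≃ₐ[𝕜] BX' 𝕜 N,
        ∀ x : CAlg 𝕜 N,
          (Ψ (Ideal.Quotient.mk (⨅ n : ℕ, augIdeal 𝕜 N ^ n) x) : BRat 𝕜) =
            Φ (toCHat 𝕜 N x) := by
  obtain ⟨M, rfl⟩ : ∃ M, N = M + 2 := ⟨N - 2, by omega⟩
  refine ⟨fun a b c d _ _ _ _ hsum hbd => omegaLift_relation 𝕜 hsum hbd, completionEquiv 𝕜 M,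
    ⟨continuous_completionEquiv M, fun a => ?_⟩, fun Φ h => eq_completionEquiv M h.1 h.2,
    separatedEquiv 𝕜 M, fun x => ?_⟩
  · rw [coe_completionEquiv, realizationHat_toCHat, realization_tGen]
  · rw [coe_completionEquiv, realizationHat_toCHat, coe_separatedEquiv_mk]
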